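/- **Setting.** Let $X\subseteq\mathbb R$ be a Borel set with a measure $\mu$, $U:X\to\mathbb R$ measurable, and $\Theta\subseteq\mathbb R$ a nonempty open interval with $\int_X e^{\theta U}\,d\mu<\infty$ for $\theta\in\Theta$. Put $V(\theta)=\log\int_X e^{\theta U}d\mu$; the exponential family is $P_\theta(dx)=e^{\theta U(x)-V(\theta)}\mu(dx)$, $\theta\in\Theta$, with Fisher information $I(\theta)=V''(\theta)$. Assume that $I>0$ on $\Theta$ and that there are an interval $\Theta_0\subseteq\Theta$ (possibly infinite) and constants $I_{\min},I_{\max},\varepsilon_0>0$ such that $I(\theta)\ge I_{\min}$ for $\theta\in\Theta_0$ and, for every $\theta_0\in\Theta_0$, $[\theta_0-\varepsilon_0,\theta_0+\varepsilon_0]\subseteq\Theta$ and $I\le I_{\max}$ on this interval. For $\beta=m+\alpha$ with an integer $m\ge 0$ and $0<\alpha\le1$, let $\Sigma=\Sigma(\beta,L)$ be the set of functions $f:[0,1]\to\Theta_0$ such that $|f|\le L$ and $|f^{(m)}(x)-f^{(m)}(y)|\le L|x-y|^{\alpha}$ for $x,y\in[0,1]$. Let $\gamma_n=\kappa_0(n/\log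 n)^{-\beta/(2\beta+1)}$ with a constant $\kappa_0>0$, and for $f_0\in\Sigma$ let $\Sigma_{f_0}(\gamma_n)=\{f\in\Sigma:\|f-f_0\|_\infty\le\gamma_n\}$. Let $\Gamma:\Theta\to\mathbb R$ be any function with $\Gamma'(\theta)=\sqrt{I(\theta)}$ on $\Theta$. For $f_0\in\Sigma$ let $\mathcal G^n_{f_0}$ be the experiment on $C[0,1]$ (with its Borel $\sigma$-field) given by the laws of the Gaussian observations $$dY_t=f(t)\,dt+n^{-1/2}I(f_0(t))^{-1/2}\,dW_t,\quad t\in[0,1],\ Y_0=0,\qquad f\in\Sigma_{f_0}(\gamma_n),$$ and $\widehat{\mathcal G}{}^n_{f_0}$ the experiment on $C[0,1]$ given by the laws of $$d\widehat Y_t=\Gamma(f(t))\,dt+n^{-1/2}\,dW_t,\quad t\in[0,1],\ \widehat Y_0=0,\qquad f\in\Sigma_{f_0}(\gamma_n),$$ where $W$ is a standard Wiener process. For experiments $\mathcal E=(P_\theta)_{\theta\in T}$ and $\mathcal F=(Q_\theta)_{\theta\in T}$ let $\delta(\mathcal E,\mathcal F)=\inf_K\sup_{\theta\in T}\|KP_\theta-Q_\theta\|$,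 with the infimum over all Markov kernels $K$ and $\|\cdot\|$ the total variation distance $\sup_A|P(A)-Q(A)|$, and let $\Delta(\mathcal E,\mathcal F)=\max\{\delta(\mathcal E,\mathcal F),\delta(\mathcal F,\mathcal E)\}$ be Le Cam's distance. **Theorem.** Let $\beta>\frac12$. Then $\mathcal G^n_{f_0}$ and $\widehat{\mathcal G}{}^n_{f_0}$ are asymptotically equivalent uniformly in $f_0\in\Sigma$, that is, $$\sup_{f_0\in\Sigma}\Delta\bigl(\mathcal G^n_{f_0},\widehat{\mathcal G}{}^n_{f_0}\bigr)\to0\quad(n\to\infty),$$ and moreover $$\sup_{f_0\in\Sigma}\Delta^2\bigl(\mathcal G^n_{f_0},\widehat{\mathcal G}{}^n_{f_0}\bigr)=O\Bigl(n^{-\frac{2\beta-1}{2\beta+1}}(\log n)^{\frac{4\beta}{2\beta+1}}\Bigr).$$ -/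

import Mathlib

open MeasureTheory ProbabilityTheory Filter Topology
open scoped ENNReal

noncomputable section

namespace VarStable

/-! ### Exponential families -/

/-- A one-dimensional, linearly indexed exponential family in canonical form: a Borel set
`X` of reals with a measure `μ`, a measurable statistic `U` on `X`, and a nonempty open interval
`Θ` on which the Laplace transform `θ ↦ ∫ exp (θ U) dμ` is finite.  Its members are the measures
`P_θ (dx) = exp (θ U(x) - V(θ)) μ(dx)`, `θ ∈ Θ`, with `V` as in `ExpFamily.cumulant`. -/
structure ExpFamily where
  X : Set ℝ
  measurableSet_X : MeasurableSet X
  μ : Measure X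
  U : X → ℝ
  measurable_U : Measurable U
  Θ : Set ℝ
  isOpen_Θ : IsOpen Θ
  ordConnected_Θ : Θ.OrdConnected
  nonempty_Θ : Θ.Nonempty
  integrable_exp : ∀ θ ∈ Θ, Integrable (fun x => Real.exp (θ * U x)) μ

/-- The cumulant generating function `V(θ) = log ∫ exp (θ U) dμ`. -/
def ExpFamily.cumulant (E : ExpFamily) (θ : ℝ) : ℝ := cgf E.U E.μ θ

/-- The Fisher information of the canonical family, `I(θ) = V''(θ)`. -/
def ExpFamily.fisher (E : ExpFamily) (θ : ℝ) : ℝ := iteratedDeriv 2 E.cumulant θ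

/-- The standing conditions on the Fisher information: it is positive on `Θ`; `Θ₀` is an interval
(possibly infinite) in `Θ`, on which it is at least `Imin > 0`; and every closed interval of
radius `ε₀ > 0` around a point of `Θ₀` lies in `Θ`, with Fisher information at most `Imax`
there. -/
structure ExpFamily.Regular (E : ExpFamily) (Θ₀ : Set ℝ) (Imin Imax ε₀ : ℝ) : Prop where
  fisher_pos : ∀ θ ∈ E.Θ, 0 < E.fisher θ
  ordConnected : Θ₀.OrdConnected
  subset : Θ₀ ⊆ E.Θ
  Imin_pos : 0 < Imin
  Imax_pos : 0 < Imax
  ε₀_pos : 0 < ε₀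
  Imin_le : ∀ θ ∈ Θ₀, Imin ≤ E.fisher θ
  le_Imax : ∀ θ₀ ∈ Θ₀, ∀ θ : ℝ, |θ - θ₀| ≤ ε₀ → θ ∈ E.Θ ∧ E.fisher θ ≤ Imax

/-! ### Parameter sets -/

/-- The Hölder ball of functions on `[0,1]` with `β = m + α`, `m` an integer, `0 < α ≤ 1`:
`|f| ≤ L` and the `m`-th derivative of `f` exists and is `α`-Hölder with constant `L`.
Derivatives on `[0,1]` are taken within `[0,1]` (one-sided at the end points). -/
def holderBall (β L : ℝ) : Set (unitInterval → ℝ) :=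
  {f | (∀ t, |f t| ≤ L) ∧
    ∃ (m : ℕ) (α : ℝ), 0 < α ∧ α ≤ 1 ∧ β = m + α ∧
      ContDiffOn ℝ m (Set.IccExtend zero_le_one f) (Set.Icc 0 1) ∧
      ∀ x ∈ Set.Icc (0 : ℝ) 1, ∀ y ∈ Set.Icc (0 : ℝ) 1,
        |iteratedDerivWithin m (Set.IccExtend zero_le_one f) (Set.Icc 0 1) x
          - iteratedDerivWithin m (Set.IccExtend zero_le_one f) (Set.Icc 0 1) y|
        ≤ L * |x - y| ^ α}

/-- The basic parameter set `Σ(β, L)`: functions of the Hölder ball with values in `Θ₀`. -/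
def paramSet (Θ₀ : Set ℝ) (β L : ℝ) : Set (unitInterval → ℝ) :=
  {f | ∀ t, f t ∈ Θ₀} ∩ holderBall β L

/-- The shrinking rate `γ_n = κ₀ (n / log n)^(-β/(2β+1))`. -/
def gammaRate (κ₀ β : ℝ) (n : ℕ) : ℝ :=
  κ₀ * ((n : ℝ) / Real.log n) ^ (-(β / (2 * β + 1)))

/-- The neighbourhood `{f ∈ Σ(β, L) : ‖f - f₀‖_∞ ≤ γ}`. -/
def localSet (Θ₀ : Set ℝ) (β L : ℝ) (f₀ : unitInterval → ℝ) (γ : ℝ) : Set (unitInterval → ℝ) :=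
  {f | f ∈ paramSet Θ₀ β L ∧ ∀ t, |f t - f₀ t| ≤ γ}

/-! ### Le Cam distance -/

/-- The total variation distance `sup_A |P(A) - Q(A)|` of two probability measures. -/
def tvDist {Ω : Type*} [MeasurableSpace Ω] (P Q : Measure Ω) : ℝ≥0∞ :=
  ⨆ (A : Set Ω) (_ : MeasurableSet A), ENNReal.ofReal |P.real A - Q.real A|

/-- The deficiency `δ(E, G) = inf_K sup_θ ‖K P_θ - Q_θ‖` of the experiment `E = (P_θ)` with respect
to the experiment `G = (Q_θ)`, the infimum being over all Markov kernels. -/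
def deficiency {T Ω₁ Ω₂ : Type*} [MeasurableSpace Ω₁] [MeasurableSpace Ω₂]
    (P : T → Measure Ω₁) (Q : T → Measure Ω₂) : ℝ≥0∞ :=
  ⨅ (K : Kernel Ω₁ Ω₂) (_ : IsMarkovKernel K), ⨆ θ : T, tvDist ((P θ).bind K) (Q θ)

/-- Le Cam's distance of two experiments with the same parameter set. -/
def leCamDist {T Ω₁ Ω₂ : Type*} [MeasurableSpace Ω₁] [MeasurableSpace Ω₂]
    (P : T → Measure Ω₁) (Q : T → Measure Ω₂) : ℝ≥0∞ :=
  max (deficiency P Q) (deficiency Q P)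

/-! ### Gaussian white noise -/

/-- The Borel σ-algebra of the uniform metric on `C[0,1]`. -/
instance instMeasurableSpacePath : MeasurableSpace C(unitInterval, ℝ) := borel _

instance instBorelSpacePath : BorelSpace C(unitInterval, ℝ) := ⟨rfl⟩

/-- `Q` is the law on `C[0,1]` of the Gaussian observation `dY_t = b(t) dt + σ(t) dW_t`, `t ∈ [0,1]`,
`Y_0 = 0`, with `b` and `σ` deterministic and `W` a standard Wiener process: the path starts at `0`
and has independent increments, where `Y_t - Y_s` is normal with mean `∫_s^t b` and variance
`∫_s^t σ²`.  (These properties determine `Q`.) -/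
structure IsWhiteNoiseLaw (b σ : unitInterval → ℝ) (Q : Measure C(unitInterval, ℝ)) : Prop where
  isProbabilityMeasure : IsProbabilityMeasure Q
  start : ∀ᵐ y ∂Q, y 0 = 0
  indep : HasIndepIncrements (fun (t : unitInterval) (y : C(unitInterval, ℝ)) => y t) Q
  law : ∀ s t : unitInterval, s ≤ t →
    HasLaw (fun y : C(unitInterval, ℝ) => y t - y s)
      (gaussianReal (∫ u in Set.Ioc s t, b u) (Real.toNNReal (∫ u in Set.Ioc s t, σ u ^ 2))) Q

end VarStable

end

open scoped NNReal

noncomputable section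

namespace VarStable

/-! ### Exponential tilting of product Gaussian measures -/

/-! Centred at `f₀` and divided by their noise levels, the two signals are `√n √I(f₀) (f - f₀)` and
`√n (Γ(f) - Γ(f₀))`. Since `Γ' = √I`, the first is the linearization of the second, and as `√I` is
Lipschitz on the bounded part of `Θ₀` where all `f` take their values, they differ by at most `C √n
γ_n²`, uniformly (`exists_taylor_bound`). For white noise with known volatility, total variation is
controlled by the L² distance of the standardized signals. This gives a squared Le Cam distance of
order `n γ_n⁴`, which is the stated rate and tends to zero exactly because `β > 1/2`.

The difficulty is that the volatilities differ, so the path laws are mutually singular in general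
and one observation cannot be compared with the other directly. A Markov kernel changes the
volatility: take the increments along a uniform grid with `N` cells, centre them at `f₀`, rescale
them to the target variances, recentre them, and fill in the path by the conditional law, given
these increments, of the target law at `f₀`. The outcome has a density with respect to that target
law which depends only on the increments (`bind_transportKernel`). By a discrete Girsanov
computation it is white noise with the target volatility whose standardized signal imitates the
original one cell by cell (`tvDist_bind_transportKernel_le`).

No rate in `N` is needed: the kernel may depend on `n` and `f₀`, and equicontinuity of the Hölder
ball lets one grid serve all `f` with an error below the Taylor error (`deficiency_whiteNoise_le`).

Only finite-dimensional Gaussian laws are computed. The bounds hold on every refinement of the grid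
with a constant independent of the refinement, and they pass to path space because the refinements
generate its Borel sets (`abs_measureReal_sub_le_of_gridIncr`). -/

theorem gaussianReal_withDensity_exp (m a : ℝ) {w : ℝ≥0} (hw : w ≠ 0) :
    (gaussianReal m w).withDensity
        (fun x => ENNReal.ofReal (Real.exp (a * (x - m) - a ^ 2 * w / 2))) =
      gaussianReal (m + a * w) w := by
  rw [gaussianReal_of_var_ne_zero _ hw, gaussianReal_of_var_ne_zero _ hw,
    ← withDensity_mul _ (measurable_gaussianPDF _ _) (by fun_prop)]
  congr 1
  ext x
  have hw' : (w : ℝ) ≠ 0 := by exact_mod_cast hw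
  simp only [Pi.mul_apply, gaussianPDF]
  rw [← ENNReal.ofReal_mul (gaussianPDFReal_nonneg _ _ _)]
  congr 1
  simp only [gaussianPDFReal]
  rw [mul_assoc, ← Real.exp_add]
  congr 2
  field_simp
  ring

/-- The indicator of a measurable box splits into factors in the single coordinates, which are
independent under the product measure. -/
theorem pi_withDensity_prod {ι : Type*} [Fintype ι] {X : ι → Type*} [∀ i, MeasurableSpace (X i)]
    (μ : ∀ i, Measure (X i)) [∀ i, IsProbabilityMeasure (μ i)] (f : ∀ i, X i → ℝ≥0∞)
    (hf : ∀ i, Measurable (f i)) [∀ i, SigmaFinite ((μ i).withDensity (f i))] :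
    (Measure.pi μ).withDensity (fun x => ∏ i, f i (x i)) =
      Measure.pi fun i => (μ i).withDensity (f i) := by
  symm
  refine Measure.pi_eq fun s hs => ?_
  rw [withDensity_apply _ (MeasurableSet.univ_pi hs), ← lintegral_indicator
    (MeasurableSet.univ_pi hs)]
  have hind : ∀ x : ∀ i, X i, (Set.univ.pi s).indicator (fun x => ∏ i, f i (x i)) x =
      ∏ i, (s i).indicator (f i) (x i) := by
    intro x
    by_cases hx : x ∈ Set.univ.pi s
    · rw [Set.indicator_of_mem hx]
      exact Finset.prod_congr rfl fun i _ => (Set.indicator_of_mem (hx i trivial) _).symm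
    · rw [Set.indicator_of_notMem hx]
      simp only [Set.mem_univ_pi, not_forall] at hx
      obtain ⟨i, hi⟩ := hx
      exact (Finset.prod_eq_zero (Finset.mem_univ i) (Set.indicator_of_notMem hi _)).symm
  simp_rw [hind]
  have hmeas : ∀ i, Measurable ((s i).indicator (f i)) := fun i => (hf i).indicator (hs i)
  rw [lintegral_prod_eq_prod_lintegral_of_indepFun Finset.univ
    (fun i (x : ∀ i, X i) => (s i).indicator (f i) (x i))
    (iIndepFun_pi (X := fun i => (s i).indicator (f i)) fun i => (hmeas i).aemeasurable)
    fun i => (hmeas i).comp (measurable_pi_apply i)]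
  refine Finset.prod_congr rfl fun i _ => ?_
  rw [withDensity_apply _ (hs i), ← lintegral_indicator (hs i),
    ← (measurePreserving_eval μ i).lintegral_comp (hmeas i)]

/-- The likelihood ratio of `⊗ N(mᵢ + aᵢ wᵢ, wᵢ)` with respect to `⊗ N(mᵢ, wᵢ)`. -/
def gaussRatio {ι : Type*} [Fintype ι] (m a : ι → ℝ) (w : ι → ℝ≥0) (x : ι → ℝ) : ℝ :=
  Real.exp (∑ i, (a i * (x i - m i) - a i ^ 2 * w i / 2))

theorem gaussRatio_pos {ι : Type*} [Fintype ι] (m a : ι → ℝ) (w : ι → ℝ≥0) (x : ι → ℝ) :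
    0 < gaussRatio m a w x := Real.exp_pos _

theorem measurable_gaussRatio {ι : Type*} [Fintype ι] (m a : ι → ℝ) (w : ι → ℝ≥0) :
    Measurable (gaussRatio m a w) := by
  unfold gaussRatio
  fun_prop

theorem pi_gaussianReal_withDensity {ι : Type*} [Fintype ι] (m a : ι → ℝ) (w : ι → ℝ≥0)
    (hw : ∀ i, w i ≠ 0) :
    (Measure.pi fun i => gaussianReal (m i) (w i)).withDensity
        (fun x => ENNReal.ofReal (gaussRatio m a w x)) =
      Measure.pi fun i => gaussianReal (m i + a i * w i) (w i) := by
  have h1 : ∀ i, (gaussianReal (m i) (w i)).withDensity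
      (fun x => ENNReal.ofReal (Real.exp (a i * (x - m i) - a i ^ 2 * w i / 2))) =
      gaussianReal (m i + a i * w i) (w i) := fun i => gaussianReal_withDensity_exp _ _ (hw i)
  have : ∀ i, SigmaFinite ((gaussianReal (m i) (w i)).withDensity
      (fun x => ENNReal.ofReal (Real.exp (a i * (x - m i) - a i ^ 2 * w i / 2)))) := by
    intro i
    rw [h1]
    infer_instance
  have h2 := pi_withDensity_prod (fun i => gaussianReal (m i) (w i))
    (fun i x => ENNReal.ofReal (Real.exp (a i * (x - m i) - a i ^ 2 * w i / 2)))
    (fun i => by fun_prop)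
  simp_rw [h1] at h2
  rw [← h2]
  congr 1
  ext x
  rw [gaussRatio, Real.exp_sum, ENNReal.ofReal_prod_of_nonneg fun i _ => (Real.exp_pos _).le]

/-- The difference is the integral of `ρ - 1` over `B`, and `√(∫ρ² - 1)` is the L² norm of `ρ - 1`.
Cauchy–Schwarz enters as nonnegativity of the variance of `|ρ - 1|`. -/
theorem abs_withDensity_real_sub_le {Ω : Type*} [MeasurableSpace Ω] (P : Measure Ω)
    [IsProbabilityMeasure P] {ρ : Ω → ℝ} (hρ : Measurable ρ) (h0 : ∀ x, 0 ≤ ρ x)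
    (h1 : Integrable ρ P) (hi1 : ∫ x, ρ x ∂P = 1) (h2 : Integrable (fun x => ρ x ^ 2) P)
    {B : Set Ω} (hB : MeasurableSet B) :
    |(P.withDensity fun x => ENNReal.ofReal (ρ x)).real B - P.real B| ≤
      Real.sqrt (∫ x, ρ x ^ 2 ∂P - 1) := by
  have hQ : (P.withDensity fun x => ENNReal.ofReal (ρ x)).real B = ∫ x in B, ρ x ∂P := by
    rw [measureReal_def, withDensity_apply _ hB,
      ← ofReal_integral_eq_lintegral_ofReal h1.integrableOn (ae_of_all _ h0),
      ENNReal.toReal_ofReal (integral_nonneg h0)]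
  have hP : P.real B = ∫ x in B, (1 : ℝ) ∂P := by simp
  have hint : Integrable (fun x => ρ x - 1) P := h1.sub (integrable_const _)
  rw [hQ, hP, ← integral_sub h1.integrableOn (integrable_const _).integrableOn]
  have hsq : Integrable (fun x => (ρ x - 1) ^ 2) P := by
    have : (fun x => (ρ x - 1) ^ 2) = fun x => ρ x ^ 2 - 2 * ρ x + 1 := by ext; ring
    rw [this]
    exact (h2.sub (h1.const_mul 2)).add (integrable_const _)
  have hsqi : ∫ x, (ρ x - 1) ^ 2 ∂P = ∫ x, ρ x ^ 2 ∂P - 1 := by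
    have : (fun x => (ρ x - 1) ^ 2) = fun x => ρ x ^ 2 - 2 * ρ x + 1 := by ext; ring
    have h12 : Integrable (fun x => ρ x ^ 2 - 2 * ρ x) P := h2.sub (h1.const_mul 2)
    rw [this, integral_add h12 (integrable_const _), integral_sub h2 (h1.const_mul 2), integral_const_mul, hi1]
    simp
    ring
  have hL2 : MemLp (fun x => |ρ x - 1|) 2 P :=
    (memLp_two_iff_integrable_sq (by fun_prop)).2 (by simpa only [sq_abs] using hsq)
  have hvar := variance_nonneg (fun x => |ρ x - 1|) P
  rw [variance_eq_sub hL2] at hvar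
  simp only [Pi.pow_apply, sq_abs] at hvar
  rw [hsqi] at hvar
  refine (abs_integral_le_integral_abs.trans (setIntegral_le_integral hint.abs
    (ae_of_all _ fun x => abs_nonneg _))).trans (Real.le_sqrt_of_sq_le (by linarith))

/-- The tilted measure is again a product of Gaussian probability measures, so its total mass gives
the integral without computation. -/
theorem integrable_gaussRatio {ι : Type*} [Fintype ι] (m a : ι → ℝ) (w : ι → ℝ≥0)
    (hw : ∀ i, w i ≠ 0) :
    Integrable (gaussRatio m a w) (Measure.pi fun i => gaussianReal (m i) (w i)) ∧
      ∫ x, gaussRatio m a w x ∂(Measure.pi fun i => gaussianReal (m i) (w i)) = 1 := by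
  have h := congrArg (fun μ => μ Set.univ) (pi_gaussianReal_withDensity m a w hw)
  simp only [withDensity_apply _ MeasurableSet.univ, Measure.restrict_univ, measure_univ] at h
  refine ⟨⟨(measurable_gaussRatio m a w).aestronglyMeasurable, ?_⟩, ?_⟩
  · rw [hasFiniteIntegral_iff_ofReal (ae_of_all _ fun x => (gaussRatio_pos m a w x).le), h]
    simp
  · rw [integral_eq_lintegral_of_nonneg_ae (ae_of_all _ fun x => (gaussRatio_pos m a w x).le)
      (measurable_gaussRatio m a w).aestronglyMeasurable, h]
    simp

/-- Squaring a likelihood ratio doubles the tilt up to a constant factor. Since every tilt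
integrates to one, that constant is the second moment. -/
theorem gaussRatio_sq {ι : Type*} [Fintype ι] (m a : ι → ℝ) (w : ι → ℝ≥0) (x : ι → ℝ) :
    gaussRatio m a w x ^ 2 =
      Real.exp (∑ i, a i ^ 2 * w i) * gaussRatio m (fun i => 2 * a i) w x := by
  rw [gaussRatio, gaussRatio, ← Real.exp_nat_mul, ← Real.exp_add, ← Finset.sum_add_distrib,
    Finset.mul_sum]
  congr 1
  refine Finset.sum_congr rfl fun i _ => ?_
  push_cast
  ring

theorem abs_pi_gaussianReal_sub_le {ι : Type*} [Fintype ι] (m m' : ι → ℝ) (w : ι → ℝ≥0)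
    (hw : ∀ i, w i ≠ 0) {B : Set (ι → ℝ)} (hB : MeasurableSet B) :
    |(Measure.pi fun i => gaussianReal (m' i) (w i)).real B -
        (Measure.pi fun i => gaussianReal (m i) (w i)).real B| ≤
      Real.sqrt (Real.exp (∑ i, (m' i - m i) ^ 2 / w i) - 1) := by
  -- The tilt that moves the mean from `m i` to `m' i`.
  set a : ι → ℝ := fun i => (m' i - m i) / w i with ha
  have hw' : ∀ i, (w i : ℝ) ≠ 0 := fun i => by exact_mod_cast hw i
  have hm : ∀ i, m i + a i * w i = m' i := fun i => by
    simp only [ha]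
    field_simp [hw' i]
    ring
  have hS : ∑ i, (m' i - m i) ^ 2 / w i = ∑ i, a i ^ 2 * w i :=
    Finset.sum_congr rfl fun i _ => by
      simp only [ha]
      field_simp [hw' i]
  have hd := pi_gaussianReal_withDensity m a w hw
  simp_rw [hm] at hd
  obtain ⟨h1, hi1⟩ := integrable_gaussRatio m a w hw
  obtain ⟨h2, hi2⟩ := integrable_gaussRatio m (fun i => 2 * a i) w hw
  have h := abs_withDensity_real_sub_le (Measure.pi fun i => gaussianReal (m i) (w i))
    (measurable_gaussRatio m a w) (fun x => (gaussRatio_pos m a w x).le) h1 hi1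
    (by simp_rw [gaussRatio_sq]; exact h2.const_mul _) hB
  rw [hd] at h
  simp_rw [gaussRatio_sq] at h
  rwa [integral_const_mul, hi2, mul_one, ← hS] at h

/-! ### Increments of paths along uniform grids -/

/-- The grid point `k / N`, truncated to `[0,1]`. -/
def gridPt (N k : ℕ) : unitInterval := Set.projIcc 0 1 zero_le_one ((k : ℝ) / N)

theorem monotone_gridPt (N : ℕ) : Monotone (gridPt N) := fun i j h =>
  Set.monotone_projIcc _ (by gcongr)

theorem gridPt_zero (N : ℕ) : gridPt N 0 = 0 := by
  simp [gridPt]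

theorem coe_gridPt {N k : ℕ} (h : k ≤ N) : (gridPt N k : ℝ) = (k : ℝ) / N := by
  rw [gridPt, Set.projIcc_of_mem]
  exact ⟨by positivity, div_le_one_of_le₀ (by exact_mod_cast h) (by positivity)⟩

theorem gridPt_of_le {N k : ℕ} (hN : 0 < N) (h : N ≤ k) : gridPt N k = 1 := by
  have : (0 : ℝ) < N := by exact_mod_cast hN
  rw [gridPt, Set.projIcc_of_right_le _ ((one_le_div this).2 (by exact_mod_cast h))]
  rfl

theorem gridPt_min {N : ℕ} (hN : 0 < N) (k : ℕ) : gridPt N (min k N) = gridPt N k := by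
  rcases le_total k N with h | h
  · rw [min_eq_left h]
  · rw [min_eq_right h, gridPt_of_le hN le_rfl, gridPt_of_le hN h]

theorem gridPt_mul_mul (N k : ℕ) {M : ℕ} (hM : 0 < M) :
    gridPt (N * M) (k * M) = gridPt N k := by
  have : (M : ℝ) ≠ 0 := by positivity
  simp only [gridPt, Nat.cast_mul]
  rw [mul_div_mul_right _ _ this]

/-- The `i`-th cell of the uniform grid with `N` cells. -/
def gridCell (N i : ℕ) : Set unitInterval := Set.Ioc (gridPt N i) (gridPt N (i + 1))

/-- The increments of a path along the uniform grid with `N` cells. -/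
def gridIncr (N : ℕ) (y : C(unitInterval, ℝ)) (i : Fin N) : ℝ :=
  y (gridPt N (i + 1)) - y (gridPt N i)

theorem measurable_eval (t : unitInterval) : Measurable fun y : C(unitInterval, ℝ) => y t :=
  (continuous_eval_const t).measurable

theorem measurable_gridIncr (N : ℕ) : Measurable (gridIncr N) :=
  measurable_pi_iff.2 fun _ => (measurable_eval _).sub (measurable_eval _)

theorem IsWhiteNoiseLaw.map_gridIncr {b σ : unitInterval → ℝ} {Q : Measure C(unitInterval, ℝ)}
    (h : IsWhiteNoiseLaw b σ Q) (N : ℕ) :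
    Q.map (gridIncr N) = Measure.pi fun i : Fin N =>
      gaussianReal (∫ u in gridCell N i, b u) (Real.toNNReal (∫ u in gridCell N i, σ u ^ 2)) := by
  have := h.isProbabilityMeasure
  have hind := h.indep N (fun i => gridPt N i) fun i j hij => monotone_gridPt N hij
  have hind' := (iIndepFun_iff_map_fun_eq_pi_map fun i : Fin N =>
    (measurable_pi_iff.1 (measurable_gridIncr N) i).aemeasurable).1 hind
  refine Eq.trans hind' ?_
  congr 1
  ext1 i
  exact (h.law (gridPt N i) (gridPt N (i + 1)) (monotone_gridPt N (Nat.le_succ i))).map_eq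

/-- The σ-algebra on path space generated by the values at the points `i / K`. -/
@[reducible]
def gridAlgebra (K : ℕ) : MeasurableSpace C(unitInterval, ℝ) :=
  MeasurableSpace.comap (fun y (i : ℕ) => y (gridPt K i)) inferInstance

theorem gridAlgebra_le_mul (K : ℕ) {M : ℕ} (hM : 0 < M) :
    gridAlgebra K ≤ gridAlgebra (K * M) := by
  rw [gridAlgebra, ← measurable_iff_comap_le]
  refine @measurable_pi_lambda _ _ _ (gridAlgebra (K * M)) _ _ fun i => ?_
  have h : Measurable[gridAlgebra (K * M)]
      (fun (y : C(unitInterval, ℝ)) (i : ℕ) => y (gridPt (K * M) i)) :=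
    comap_measurable _
  have h2 := (measurable_pi_apply (i * M)).comp h
  simpa only [Function.comp_def, gridPt_mul_mul K i hM] using h2

theorem gridAlgebra_le (K : ℕ) : gridAlgebra K ≤ instMeasurableSpacePath :=
  measurable_iff_comap_le.1 (measurable_pi_lambda _ fun _ => measurable_eval _)

/-- The events that depend on the values at finitely many points of some grid with a multiple of
`N` cells. -/
def gridEvents (N : ℕ) : Set (Set C(unitInterval, ℝ)) :=
  {A | ∃ M : ℕ, 0 < M ∧ MeasurableSet[gridAlgebra (N * M)] A}

theorem isSetAlgebra_gridEvents (N : ℕ) : IsSetAlgebra (gridEvents N) where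
  empty_mem := ⟨1, one_pos, @MeasurableSet.empty _ (gridAlgebra _)⟩
  compl_mem := fun _ ⟨M, hM, h⟩ => ⟨M, hM, h.compl⟩
  union_mem := fun s t ⟨M, hM, h⟩ ⟨M', hM', h'⟩ => by
    refine ⟨M * M', Nat.mul_pos hM hM', MeasurableSet.union ?_ ?_⟩
    · have := gridAlgebra_le_mul (N * M) hM' s h
      rwa [mul_assoc] at this
    · have := gridAlgebra_le_mul (N * M') hM t h'
      rwa [mul_assoc, mul_comm M'] at this

theorem tendsto_gridPt {N : ℕ} (hN : 0 < N) (t : unitInterval) :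
    Tendsto (fun M : ℕ => gridPt (N * (M + 1)) ⌊(t : ℝ) * ((N * (M + 1) : ℕ) : ℝ)⌋₊) atTop
      (𝓝 t) := by
  have hK : Tendsto (fun M : ℕ => ((N * (M + 1) : ℕ) : ℝ)) atTop atTop := by
    refine tendsto_natCast_atTop_atTop.comp ?_
    exact (tendsto_add_atTop_nat 1).const_mul_atTop' hN
  have h := (tendsto_nat_floor_mul_div_atTop (R := ℝ) t.2.1).comp hK
  have h2 := ((continuous_projIcc (h := zero_le_one (α := ℝ))).tendsto (t : ℝ)).comp h
  rwa [Set.projIcc_val] at h2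

/-- Evaluation at countably many dense grid points is a continuous injection from a Polish space
into a countable product of lines, hence a measurable embedding by the Lusin–Souslin theorem. The
Borel sets are therefore generated by these evaluations. -/
theorem borel_path_eq_generateFrom {N : ℕ} (hN : 0 < N) :
    instMeasurableSpacePath = MeasurableSpace.generateFrom (gridEvents N) := by
  refine le_antisymm ?_ (MeasurableSpace.generateFrom_le fun A ⟨M, _, h⟩ => gridAlgebra_le _ A h)
  let e : C(unitInterval, ℝ) → ℕ × ℕ → ℝ := fun y p => y (gridPt (N * (p.1 + 1)) p.2)
  have hcont : Continuous e := continuous_pi fun p => continuous_eval_const _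
  have hinj : Function.Injective e := by
    intro y z hyz
    ext t
    have hy := (y.continuous.tendsto t).comp (tendsto_gridPt hN t)
    have hz := (z.continuous.tendsto t).comp (tendsto_gridPt hN t)
    refine tendsto_nhds_unique hy (hz.congr fun M => ?_)
    exact (congrFun hyz (M, _)).symm
  have hemb : MeasurableEmbedding e := hcont.measurableEmbedding hinj
  rw [← hemb.comap_eq, ← measurable_iff_comap_le]
  refine @measurable_pi_lambda _ _ _ (MeasurableSpace.generateFrom (gridEvents N)) _ _ fun p => ?_
  intro s hs
  refine MeasurableSpace.measurableSet_generateFrom ⟨p.1 + 1, Nat.succ_pos _, ?_⟩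
  exact ⟨(fun x : ℕ → ℝ => x p.2) ⁻¹' s, measurable_pi_apply _ hs, rfl⟩

/-- The partial sums of a finite sequence of increments. -/
def partialSums (K : ℕ) (x : Fin K → ℝ) (i : ℕ) : ℝ := ∑ j : Fin K, if (j : ℕ) < i then x j else 0

theorem measurable_partialSums (K : ℕ) : Measurable (partialSums K) := by
  refine measurable_pi_lambda _ fun i => ?_
  unfold partialSums
  refine Finset.measurable_sum _ fun j _ => ?_
  split_ifs
  · exact measurable_pi_apply j
  · exact measurable_const

theorem partialSums_gridIncr {K : ℕ} (hK : 0 < K) {y : C(unitInterval, ℝ)} (hy : y 0 = 0) (i : ℕ) :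
    partialSums K (gridIncr K y) i = y (gridPt K i) := by
  unfold partialSums gridIncr
  rw [Fin.sum_univ_eq_sum_range
    (fun j => if j < i then y (gridPt K (j + 1)) - y (gridPt K j) else 0), ← Finset.sum_filter]
  have : (Finset.range K).filter (fun j => j < i) = Finset.range (min i K) := by
    ext j
    simp [and_comm]
  rw [this, Finset.sum_range_sub (fun j => y (gridPt K j)), gridPt_min hK, gridPt_zero, hy, sub_zero]

/-- Two laws of continuous paths starting at `0` are close in total variation if the laws of their
increments along all grids refining a given uniform grid are. -/
theorem abs_measureReal_sub_le_of_gridIncr {P Q : Measure C(unitInterval, ℝ)}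
    [IsProbabilityMeasure P] [IsProbabilityMeasure Q] (hP : ∀ᵐ y ∂P, y 0 = 0)
    (hQ : ∀ᵐ y ∂Q, y 0 = 0) {N : ℕ} (hN : 0 < N) {c : ℝ}
    (h : ∀ M : ℕ, 0 < M → ∀ B : Set (Fin (N * M) → ℝ), MeasurableSet B →
      |(P.map (gridIncr (N * M))).real B - (Q.map (gridIncr (N * M))).real B| ≤ c)
    {A : Set C(unitInterval, ℝ)} (hA : MeasurableSet A) : |P.real A - Q.real A| ≤ c := by
  have hev : ∀ A ∈ gridEvents N, |P.real A - Q.real A| ≤ c := by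
    rintro _ ⟨M, hM, B, hB, rfl⟩
    have hB' := measurable_partialSums (N * M) hB
    -- A path starting at `0` has its grid values determined by its increments, so a grid event is
    -- almost surely an event about increments.
    have key : ∀ ν : Measure C(unitInterval, ℝ), (∀ᵐ y ∂ν, y 0 = 0) →
        ν.real ((fun y (i : ℕ) => y (gridPt (N * M) i)) ⁻¹' B) =
          (ν.map (gridIncr (N * M))).real (partialSums (N * M) ⁻¹' B) := by
      intro ν hν
      rw [map_measureReal_apply (measurable_gridIncr _) hB']
      refine measureReal_congr ?_
      filter_upwards [hν] with y hy
      have : partialSums (N * M) (gridIncr (N * M) y) = fun i => y (gridPt (N * M) i) :=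
        funext fun i => partialSums_gridIncr (Nat.mul_pos hN hM) hy i
      refine propext ?_
      change (fun i => y (gridPt (N * M) i)) ∈ B ↔ partialSums (N * M) (gridIncr (N * M) y) ∈ B
      rw [this]
    rw [key P hP, key Q hQ]
    exact h M hM _ hB'
  refine le_of_forall_pos_le_add fun ε hε => ?_
  -- Approximation with respect to `P + Q` controls the error under both laws at once.
  have hd := Measure.MeasureDense.of_generateFrom_isSetAlgebra_finite (P + Q)
    (isSetAlgebra_gridEvents N) (borel_path_eq_generateFrom hN)
  obtain ⟨t, ht, hlt⟩ := hd.approx A hA (measure_ne_top _ _) ε hε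
  have htm := hd.measurable t ht
  rw [Measure.add_apply] at hlt
  have hsum : P.real (symmDiff A t) + Q.real (symmDiff A t) < ε := by
    rw [measureReal_def, measureReal_def, ← ENNReal.toReal_add (measure_ne_top _ _)
      (measure_ne_top _ _)]
    exact ENNReal.toReal_lt_of_lt_ofReal hlt
  have h1 := abs_measureReal_sub_le_measureReal_symmDiff (μ := P) hA.nullMeasurableSet
    htm.nullMeasurableSet
  have h2 := abs_measureReal_sub_le_measureReal_symmDiff (μ := Q) hA.nullMeasurableSet
    htm.nullMeasurableSet
  have h3 := hev t ht
  rw [abs_le] at *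
  constructor <;> linarith [h1.1, h1.2, h2.1, h2.2, h3.1, h3.2]

/-! ### Transport of experiments by conditioning -/

/-- If the statistic `T` has under `P` the law with density `r` with respect to the law of `G` under
`ν`, then applying to `T` the conditional distribution of `ν` given `G` turns `P` into the measure
with density `r ∘ G` with respect to `ν`. -/
theorem bind_comap_condDistrib {Ω Ω' S : Type*} [MeasurableSpace Ω] [MeasurableSpace Ω']
    [StandardBorelSpace Ω'] [Nonempty Ω'] [MeasurableSpace S] (P : Measure Ω) (ν : Measure Ω')
    [IsProbabilityMeasure ν] {T : Ω → S} (hT : Measurable T) {G : Ω' → S} (hG : Measurable G)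
    {r : S → ℝ≥0∞} (hr : Measurable r) (h : P.map T = (ν.map G).withDensity r) :
    P.bind ((condDistrib id G ν).comap T hT) = ν.withDensity (r ∘ G) := by
  ext A hA
  have hk : Measurable fun s => condDistrib id G ν s A := Kernel.measurable_coe _ hA
  rw [Measure.bind_apply hA (Kernel.aemeasurable _), withDensity_apply _ hA]
  simp_rw [Kernel.comap_apply]
  rw [← lintegral_map (f := fun s => condDistrib id G ν s A) hk hT, h,
    lintegral_withDensity_eq_lintegral_mul _ hr hk]
  -- Disintegration of the joint law of `G` and the identity under `ν`, tested below against `r(s)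
  -- 1_A(y)`.
  have hc := compProd_map_condDistrib (μ := ν) (X := G) (Y := id) (mβ := inferInstance) aemeasurable_id
  have hf : Measurable fun p : S × Ω' => r p.1 * A.indicator 1 p.2 :=
    (hr.comp measurable_fst).mul ((measurable_one.indicator hA).comp measurable_snd)
  have h1 := congrArg (fun μ => ∫⁻ p, r p.1 * A.indicator 1 p.2 ∂μ) hc
  have : IsProbabilityMeasure (ν.map G) := Measure.isProbabilityMeasure_map hG.aemeasurable
  rw [Measure.lintegral_compProd hf, lintegral_map hf (hG.prodMk measurable_id)] at h1
  rw [← lintegral_indicator hA]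
  refine Eq.trans (lintegral_congr fun s => ?_) (h1.trans (lintegral_congr fun y => ?_))
  · dsimp only
    rw [lintegral_const_mul _ (measurable_one.indicator hA), lintegral_indicator_one hA]
    rfl
  · by_cases hy : y ∈ A <;> simp [hy]

/-! ### Integrals over grid cells -/

theorem integrableOn_of_continuous {g : unitInterval → ℝ} (hg : Continuous g)
    (A : Set unitInterval) : IntegrableOn g A :=
  (hg.integrable_of_hasCompactSupport (HasCompactSupport.of_compactSpace g)).integrableOn

theorem setIntegral_Ioc_eq_sub {g : unitInterval → ℝ} (hg : Continuous g) {s t : unitInterval}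
    (hst : s ≤ t) :
    ∫ u in Set.Ioc s t, g u = (∫ u in Set.Ioc 0 t, g u) - ∫ u in Set.Ioc 0 s, g u := by
  rw [← Set.Ioc_union_Ioc_eq_Ioc unitInterval.nonneg' hst, setIntegral_union
    (Set.Ioc_disjoint_Ioc_of_le le_rfl) measurableSet_Ioc
    (integrableOn_of_continuous hg _) (integrableOn_of_continuous hg _)]
  ring

theorem sum_range_mul_div (N M : ℕ) (hM : 0 < M) (F : ℕ → ℕ → ℝ) :
    ∑ j ∈ Finset.range (N * M), F (j / M) j =
      ∑ k ∈ Finset.range N, ∑ i ∈ Finset.range M, F k (k * M + i) := by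
  induction N with
  | zero => simp
  | succ N ih =>
    rw [Nat.succ_mul, Finset.sum_range_add, ih, Finset.sum_range_succ]
    congr 1
    refine Finset.sum_congr rfl fun i hi => ?_
    rw [Nat.mul_comm N M, Nat.mul_add_div hM, Nat.div_eq_of_lt (Finset.mem_range.1 hi), add_zero]

/-- Riemann–Stieltjes sums of a function that is constant on the cells of a uniform grid do not
change when the grid is refined. -/
theorem sum_fine_eq_sum_coarse (N M : ℕ) (hM : 0 < M) (c : ℕ → ℝ) (g : unitInterval → ℝ) :
    ∑ j : Fin (N * M), c (j / M) * (g (gridPt (N * M) (j + 1)) - g (gridPt (N * M) j)) =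
      ∑ k : Fin N, c k * (g (gridPt N (k + 1)) - g (gridPt N k)) := by
  rw [Fin.sum_univ_eq_sum_range
      (fun j => c (j / M) * (g (gridPt (N * M) (j + 1)) - g (gridPt (N * M) j))),
    Fin.sum_univ_eq_sum_range (fun k => c k * (g (gridPt N (k + 1)) - g (gridPt N k))),
    sum_range_mul_div N M hM
      (fun k j => c k * (g (gridPt (N * M) (j + 1)) - g (gridPt (N * M) j)))]
  refine Finset.sum_congr rfl fun k _ => ?_
  rw [← Finset.mul_sum]
  congr 1
  have := Finset.sum_range_sub (fun i => g (gridPt (N * M) (k * M + i))) M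
  simp only [add_zero] at this
  rw [gridPt_mul_mul N k hM, show k * M + M = (k + 1) * M by ring, gridPt_mul_mul N (k + 1) hM]
    at this
  exact this

theorem volume_gridCell {N k : ℕ} (hk : k < N) :
    volume.real (gridCell N k) = 1 / N := by
  rw [measureReal_def, gridCell, unitInterval.volume_Ioc, coe_gridPt hk, coe_gridPt hk.le,
    ENNReal.toReal_ofReal]
  · push_cast
    ring
  · rw [sub_nonneg]
    gcongr
    simp

theorem measurableSet_gridCell (N k : ℕ) : MeasurableSet (gridCell N k) := measurableSet_Ioc

theorem dist_lt_of_mem_gridCell {N k : ℕ} (hk : k < N) {s t : unitInterval}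
    (hs : s ∈ gridCell N k) (ht : t ∈ gridCell N k) : |(s : ℝ) - t| < 1 / N := by
  have e : ((k + 1 : ℕ) : ℝ) / N = (k : ℝ) / N + 1 / N := by push_cast; ring
  have hs1 : (gridPt N k : ℝ) < s := hs.1
  have hs2 : (s : ℝ) ≤ gridPt N (k + 1) := hs.2
  have ht1 : (gridPt N k : ℝ) < t := ht.1
  have ht2 : (t : ℝ) ≤ gridPt N (k + 1) := ht.2
  rw [coe_gridPt hk.le] at hs1 ht1
  rw [coe_gridPt hk, e] at hs2 ht2
  rw [abs_lt]
  constructor <;> linarith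

theorem setIntegral_gridCell_bounds {g : unitInterval → ℝ} (hg : Continuous g) {N k : ℕ}
    (hk : k < N) {lo hi : ℝ} (h : ∀ t ∈ gridCell N k, lo ≤ g t ∧ g t ≤ hi) :
    lo * (1 / N) ≤ ∫ u in gridCell N k, g u ∧ ∫ u in gridCell N k, g u ≤ hi * (1 / N) := by
  have hc : ∀ c : ℝ, ∫ u in gridCell N k, c = c * (1 / N) := fun c => by
    rw [setIntegral_const, volume_gridCell hk, smul_eq_mul, mul_comm]
  rw [← hc, ← hc]
  exact ⟨setIntegral_mono_on (integrableOn_of_continuous continuous_const _)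
      (integrableOn_of_continuous hg _) (measurableSet_gridCell N k) fun t ht => (h t ht).1,
    setIntegral_mono_on (integrableOn_of_continuous hg _)
      (integrableOn_of_continuous continuous_const _) (measurableSet_gridCell N k)
      fun t ht => (h t ht).2⟩

theorem setIntegral_gridCell_pos {g : unitInterval → ℝ} (hg : Continuous g) (h0 : ∀ t, 0 < g t)
    {N k : ℕ} (hk : k < N) : 0 < ∫ u in gridCell N k, g u := by
  obtain ⟨x, -, hx⟩ := isCompact_univ.exists_isMinOn Set.univ_nonempty hg.continuousOn
  obtain ⟨y, -, hy⟩ := isCompact_univ.exists_isMaxOn Set.univ_nonempty hg.continuousOn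
  have hN : (0 : ℝ) < N := by exact_mod_cast (Nat.zero_le k).trans_lt hk
  refine lt_of_lt_of_le (mul_pos (h0 x) (by positivity)) (setIntegral_gridCell_bounds hg hk
    (lo := g x) (hi := g y) fun t _ => ⟨hx (Set.mem_univ t), hy (Set.mem_univ t)⟩).1

/-- A bound for the contribution of one cell to the squared distance of two signals. -/
theorem sq_setIntegral_div_le {σ φ : unitInterval → ℝ} (hσ : Continuous σ) (hφ : Continuous φ)
    (h0 : ∀ t, 0 < σ t) {N k : ℕ} (hk : k < N) {c : ℝ}
    (h : ∀ t ∈ gridCell N k, |φ t| ≤ c * σ t) :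
    (∫ u in gridCell N k, φ u) ^ 2 / (∫ u in gridCell N k, σ u ^ 2) ≤ c ^ 2 * (1 / N) := by
  have hV : 0 < ∫ u in gridCell N k, σ u ^ 2 :=
    setIntegral_gridCell_pos (hσ.pow 2) (fun t => pow_pos (h0 t) 2) hk
  have hN : (0 : ℝ) < N := by exact_mod_cast (Nat.zero_le k).trans_lt hk
  rw [div_le_iff₀ hV]
  have h1 : ∫ u in gridCell N k, φ u ^ 2 ≤ c ^ 2 * ∫ u in gridCell N k, σ u ^ 2 := by
    rw [← integral_const_mul]
    refine setIntegral_mono_on (integrableOn_of_continuous (hφ.pow 2) _)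
      (integrableOn_of_continuous ((hσ.pow 2).const_mul _) _) (measurableSet_gridCell N k)
      fun t ht => ?_
    rw [← mul_pow, ← sq_abs (φ t)]
    exact pow_le_pow_left₀ (abs_nonneg _) (h t ht) 2
  -- Cauchy–Schwarz on a cell of length `1 / N`, from the integral of the squared deviation of `φ`
  -- from its mean `N * I`.
  have h2 : (∫ u in gridCell N k, φ u) ^ 2 ≤ (1 / N) * ∫ u in gridCell N k, φ u ^ 2 := by
    set I := ∫ u in gridCell N k, φ u
    have h3 : 0 ≤ ∫ u in gridCell N k, (φ u - N * I) ^ 2 := integral_nonneg fun u => sq_nonneg _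
    have h4 : ∫ u in gridCell N k, (φ u - N * I) ^ 2 =
        (∫ u in gridCell N k, φ u ^ 2) - 2 * (N * I) * I + (N * I) ^ 2 * (1 / N) := by
      have e : ∀ u, (φ u - N * I) ^ 2 = φ u ^ 2 - 2 * (N * I) * φ u + (N * I) ^ 2 := fun u => by ring
      simp_rw [e]
      have i1 : IntegrableOn (fun u => φ u ^ 2) (gridCell N k) :=
        integrableOn_of_continuous (hφ.pow 2) _
      have i2 : IntegrableOn (fun u => 2 * (N * I) * φ u) (gridCell N k) :=
        integrableOn_of_continuous (hφ.const_mul _) _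
      have i12 : IntegrableOn (fun u => φ u ^ 2 - 2 * (N * I) * φ u) (gridCell N k) := i1.sub i2
      rw [integral_add i12 (integrableOn_of_continuous continuous_const _), integral_sub i1 i2,
        integral_const_mul, setIntegral_const, volume_gridCell hk, smul_eq_mul]
      ring
    rw [h4] at h3
    have h5 : (∫ u in gridCell N k, φ u ^ 2) - 2 * (N * I) * I + (N * I) ^ 2 * (1 / N) =
        (∫ u in gridCell N k, φ u ^ 2) - N * I ^ 2 := by
      field_simp
      ring
    rw [h5] at h3
    rw [one_div, inv_mul_eq_div, le_div_iff₀ hN]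
    linarith
  calc _ ≤ (1 / N) * ∫ u in gridCell N k, φ u ^ 2 := h2
    _ ≤ (1 / N) * (c ^ 2 * ∫ u in gridCell N k, σ u ^ 2) := by gcongr
    _ = _ := by ring

/-! ### The transported experiment -/

/-- The centred, rescaled and recentred increments of the observed path. -/
def rescaledIncr (N : ℕ) (m m' s : Fin N → ℝ) (y : C(unitInterval, ℝ)) (i : Fin N) : ℝ :=
  s i * (gridIncr N y i - m i) + m' i

theorem measurable_rescaledIncr (N : ℕ) (m m' s : Fin N → ℝ) :
    Measurable (rescaledIncr N m m' s) :=
  measurable_pi_iff.2 fun i =>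
    (((measurable_pi_iff.1 (measurable_gridIncr N) i).sub_const _).const_mul _).add_const _

theorem IsWhiteNoiseLaw.map_rescaledIncr {b σ : unitInterval → ℝ} {Q : Measure C(unitInterval, ℝ)}
    (h : IsWhiteNoiseLaw b σ Q) (N : ℕ) (m m' s : Fin N → ℝ) :
    Q.map (rescaledIncr N m m' s) = Measure.pi fun i : Fin N =>
      gaussianReal (s i * ((∫ u in gridCell N i, b u) - m i) + m' i)
        (Real.toNNReal (s i ^ 2 * ∫ u in gridCell N i, σ u ^ 2)) := by
  have e : rescaledIncr N m m' s = (fun x i => s i * (x i - m i) + m' i) ∘ gridIncr N := rfl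
  rw [e, ← Measure.map_map (by fun_prop) (measurable_gridIncr N), h.map_gridIncr,
    Measure.pi_map_pi (f := fun i x => s i * (x - m i) + m' i) (fun i => by fun_prop)]
  congr 1
  ext1 i
  have e2 : (fun x => s i * (x - m i) + m' i) = (fun x => x + m' i) ∘ (fun x => s i * x) ∘
    (fun x => x - m i) := rfl
  rw [e2, ← Measure.map_map (by fun_prop) (by fun_prop), ← Measure.map_map (by fun_prop)
    (by fun_prop), gaussianReal_map_sub_const, gaussianReal_map_const_mul,
    gaussianReal_map_add_const]
  congr 1
  rw [Real.toNNReal_mul (sq_nonneg _)]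
  congr 1
  ext
  simp [Real.coe_toNNReal _ (sq_nonneg (s i))]

theorem map_withDensity_comp {Ω S : Type*} [MeasurableSpace Ω] [MeasurableSpace S] (μ : Measure Ω)
    {X : Ω → S} (hX : Measurable X) {r : S → ℝ≥0∞} (hr : Measurable r) :
    (μ.withDensity (r ∘ X)).map X = (μ.map X).withDensity r := by
  ext B hB
  rw [Measure.map_apply hX hB, withDensity_apply _ (hX hB), withDensity_apply _ hB,
    setLIntegral_map hB hr hX]
  rfl

/-- The variances of the increments of a white noise path. -/
def cellVar (σ : unitInterval → ℝ) (N k : ℕ) : ℝ≥0 :=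
  Real.toNNReal (∫ u in gridCell N k, σ u ^ 2)

theorem coe_cellVar (σ : unitInterval → ℝ) (N k : ℕ) :
    (cellVar σ N k : ℝ) = ∫ u in gridCell N k, σ u ^ 2 :=
  Real.coe_toNNReal _ (integral_nonneg fun _ => sq_nonneg _)

theorem cellVar_ne_zero {σ : unitInterval → ℝ} (hσ : Continuous σ) (h0 : ∀ t, 0 < σ t) {N k : ℕ}
    (hk : k < N) : cellVar σ N k ≠ 0 := by
  refine (Real.toNNReal_pos.2 ?_).ne'
  exact setIntegral_gridCell_pos (hσ.pow 2) (fun t => pow_pos (h0 t) 2) hk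

/-- The exponent is the Girsanov exponent `∫ a d(y - ∫b) - ½ ∫ a² σ²` of a step function `a`, and
such sums do not see a refinement. A density defined on the coarse grid can thus be read on any
finer one. -/
theorem gaussRatio_gridIncr_refine {b σ : unitInterval → ℝ} (hb : Continuous b) (hσ : Continuous σ)
    (N M : ℕ) (hM : 0 < M) (a : ℕ → ℝ) (y : C(unitInterval, ℝ)) :
    gaussRatio (fun i : Fin N => ∫ u in gridCell N i, b u) (fun i => a i)
        (fun i => cellVar σ N i) (gridIncr N y) =
      gaussRatio (fun j : Fin (N * M) => ∫ u in gridCell (N * M) j, b u) (fun j => a (j / M))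
        (fun j => cellVar σ (N * M) j) (gridIncr (N * M) y) := by
  unfold gaussRatio gridIncr
  congr 1
  have key : ∀ (K : ℕ) (c : ℕ → ℝ), ∑ i : Fin K, (c i *
      (y (gridPt K (i + 1)) - y (gridPt K i) - ∫ u in gridCell K i, b u) -
        c i ^ 2 * cellVar σ K i / 2) =
      ∑ i : Fin K, c i * ((y (gridPt K (i + 1)) - ∫ u in Set.Ioc 0 (gridPt K (i + 1)), b u) -
        (y (gridPt K i) - ∫ u in Set.Ioc 0 (gridPt K i), b u)) -
      ∑ i : Fin K, (c i ^ 2 / 2) * ((∫ u in Set.Ioc 0 (gridPt K (i + 1)), σ u ^ 2) -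
        ∫ u in Set.Ioc 0 (gridPt K i), σ u ^ 2) := by
    intro K c
    rw [← Finset.sum_sub_distrib]
    refine Finset.sum_congr rfl fun i _ => ?_
    rw [coe_cellVar, gridCell,
      setIntegral_Ioc_eq_sub hb (monotone_gridPt K (Nat.le_succ i)),
      setIntegral_Ioc_eq_sub (g := fun u => σ u ^ 2) (hσ.pow 2) (monotone_gridPt K (Nat.le_succ i))]
    ring
  rw [key N a, key (N * M) fun j => a (j / M),
    sum_fine_eq_sum_coarse N M hM a (fun t => y t - ∫ u in Set.Ioc 0 t, b u),
    sum_fine_eq_sum_coarse N M hM (fun k => a k ^ 2 / 2) (fun t => ∫ u in Set.Ioc 0 t, σ u ^ 2)]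

/-- The slope, on the `k`-th cell, of the signal that the transported increments carry, relative to
the variance of the target noise. -/
def cellSlope (d σ σ' : unitInterval → ℝ) (N k : ℕ) : ℝ :=
  (∫ u in gridCell N k, d u) /
    Real.sqrt ((∫ u in gridCell N k, σ u ^ 2) * ∫ u in gridCell N k, σ' u ^ 2)

/-- The factors that turn the variances of the increments of noise with volatility `σ` into those
of noise with volatility `σ'`. -/
def cellScale (σ σ' : unitInterval → ℝ) (N k : ℕ) : ℝ :=
  Real.sqrt ((∫ u in gridCell N k, σ' u ^ 2) / ∫ u in gridCell N k, σ u ^ 2)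

/-- The kernel that rescales the increments along a grid and fills in the path according to the
conditional law `R` given its increments. -/
def transportKernel (b b' σ σ' : unitInterval → ℝ) (N : ℕ) (R : Measure C(unitInterval, ℝ))
    [IsProbabilityMeasure R] : Kernel C(unitInterval, ℝ) C(unitInterval, ℝ) :=
  (condDistrib id (gridIncr N) R).comap
    (rescaledIncr N (fun i => ∫ u in gridCell N i, b u) (fun i => ∫ u in gridCell N i, b' u)
      fun i => cellScale σ σ' N i) (measurable_rescaledIncr _ _ _ _)

instance (b b' σ σ' : unitInterval → ℝ) (N : ℕ) (R : Measure C(unitInterval, ℝ))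
    [IsProbabilityMeasure R] : IsMarkovKernel (transportKernel b b' σ σ' N R) := by
  unfold transportKernel
  infer_instance

/-- After rescaling, the increments under `P` have the same variances as under `R`, so their laws
differ by a Gaussian tilt only. Filling in the path by the conditional law of `R` carries this tilt
over to path space. -/
theorem bind_transportKernel {b₀ b b' σ σ' : unitInterval → ℝ} (hb₀ : Continuous b₀)
    (hb : Continuous b) (hσ : Continuous σ) (hσ' : Continuous σ')
    (h0 : ∀ t, 0 < σ t) (h0' : ∀ t, 0 < σ' t) {P R : Measure C(unitInterval, ℝ)}
    [IsProbabilityMeasure R] (hP : IsWhiteNoiseLaw b σ P) (hR : IsWhiteNoiseLaw b' σ' R) (N : ℕ) :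
    P.bind (transportKernel b₀ b' σ σ' N R) = R.withDensity
      ((fun x => ENNReal.ofReal (gaussRatio (fun i : Fin N => ∫ u in gridCell N i, b' u)
        (fun i => cellSlope (fun u => b u - b₀ u) σ σ' N i) (fun i => cellVar σ' N i) x)) ∘
        gridIncr N) := by
  refine bind_comap_condDistrib P R (measurable_rescaledIncr _ _ _ _) (measurable_gridIncr N)
    (measurable_gaussRatio _ _ _).ennreal_ofReal ?_
  rw [hP.map_rescaledIncr, hR.map_gridIncr]
  refine Eq.trans ?_ (pi_gaussianReal_withDensity _ _ _
    fun i : Fin N => cellVar_ne_zero hσ' h0' i.2).symm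
  congr 1
  ext1 i
  have hV : 0 < ∫ u in gridCell N i, σ u ^ 2 :=
    setIntegral_gridCell_pos (hσ.pow 2) (fun t => pow_pos (h0 t) 2) i.2
  have hV' : 0 < ∫ u in gridCell N i, σ' u ^ 2 :=
    setIntegral_gridCell_pos (hσ'.pow 2) (fun t => pow_pos (h0' t) 2) i.2
  congr 1
  · rw [coe_cellVar, cellSlope, cellScale, integral_sub (integrableOn_of_continuous hb _)
      (integrableOn_of_continuous hb₀ _), Real.sqrt_div hV'.le, Real.sqrt_mul hV.le, add_comm]
    congr 1
    have h1 := Real.sqrt_pos.2 hV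
    have h2 := Real.sqrt_pos.2 hV'
    have h3 := Real.mul_self_sqrt hV'.le
    field_simp
    rw [pow_two, h3, mul_comm]
  · rw [cellScale, Real.sq_sqrt (by positivity), cellVar, div_mul_cancel₀ _ hV.ne']

/-- On each refinement the transported path has Gaussian increments, with drift `b₀' + a σ'²` for
the coarse slope `a`. Each of the `N * M` cells adds at most `c² / (N * M)` to the exponent of the
second moment, so the total `c²` is independent of `M`. -/
theorem tvDist_bind_transportKernel_le {b₀ b b₀' b' σ σ' : unitInterval → ℝ}
    (hb₀ : Continuous b₀) (hb : Continuous b) (hb₀' : Continuous b₀') (hb' : Continuous b')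
    (hσ : Continuous σ) (hσ' : Continuous σ') (h0 : ∀ t, 0 < σ t) (h0' : ∀ t, 0 < σ' t)
    {P R Q : Measure C(unitInterval, ℝ)} [IsProbabilityMeasure R] (hP : IsWhiteNoiseLaw b σ P)
    (hR : IsWhiteNoiseLaw b₀' σ' R) (hQ : IsWhiteNoiseLaw b' σ' Q) {N : ℕ} (hN : 0 < N) {c : ℝ}
    (hc : ∀ k < N, ∀ t ∈ gridCell N k, |cellSlope (fun u => b u - b₀ u) σ σ' N k * σ' t -
      (b' t - b₀' t) / σ' t| ≤ c) :
    tvDist (P.bind (transportKernel b₀ b₀' σ σ' N R)) Q ≤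
      ENNReal.ofReal (Real.sqrt (Real.exp (c ^ 2) - 1)) := by
  have hPp := hP.isProbabilityMeasure
  have hQp := hQ.isProbabilityMeasure
  have hprob : IsProbabilityMeasure (P.bind (transportKernel b₀ b₀' σ σ' N R)) := by
    infer_instance
  have hbind := bind_transportKernel hb₀ hb hσ hσ' h0 h0' hP hR N
  set P' := P.bind (transportKernel b₀ b₀' σ σ' N R)
  have hstart : ∀ᵐ y ∂P', y 0 = 0 := by
    rw [hbind]
    exact (withDensity_absolutelyContinuous _ _).ae_le hR.start
  refine iSup₂_le fun A hA => ENNReal.ofReal_le_ofReal ?_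
  refine abs_measureReal_sub_le_of_gridIncr hstart hQ.start hN (fun M hM B hB => ?_) hA
  set a := cellSlope (fun u => b u - b₀ u) σ σ' N with ha
  have hre : ((fun x => ENNReal.ofReal (gaussRatio (fun i : Fin N => ∫ u in gridCell N i, b₀' u)
        (fun i => a i) (fun i => cellVar σ' N i) x)) ∘ gridIncr N) =
      ((fun x => ENNReal.ofReal (gaussRatio
        (fun j : Fin (N * M) => ∫ u in gridCell (N * M) j, b₀' u) (fun j => a (j / M))
        (fun j => cellVar σ' (N * M) j) x)) ∘ gridIncr (N * M)) := by
    ext y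
    simp only [Function.comp_apply]
    rw [gaussRatio_gridIncr_refine hb₀' hσ' N M hM a y]
  have hlaw : P'.map (gridIncr (N * M)) = Measure.pi fun j : Fin (N * M) => gaussianReal
      ((∫ u in gridCell (N * M) j, b₀' u) + a (j / M) * cellVar σ' (N * M) j)
      (cellVar σ' (N * M) j) := by
    rw [hbind, hre, map_withDensity_comp _ (measurable_gridIncr _)
      (measurable_gaussRatio _ _ _).ennreal_ofReal, hR.map_gridIncr]
    exact pi_gaussianReal_withDensity _ _ _ fun j : Fin (N * M) => cellVar_ne_zero hσ' h0' j.2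
  rw [hlaw, hQ.map_gridIncr]
  refine (abs_pi_gaussianReal_sub_le _ _ (fun j : Fin (N * M) => cellVar σ' (N * M) j)
    (fun j => cellVar_ne_zero hσ' h0' j.2) hB).trans ?_
  refine Real.sqrt_le_sqrt (sub_le_sub_right (Real.exp_le_exp.2 ?_) 1)
  have hNM : (0 : ℝ) < ((N * M : ℕ) : ℝ) := by exact_mod_cast Nat.mul_pos hN hM
  have hcell : ∀ j : Fin (N * M), ((∫ u in gridCell (N * M) j, b₀' u) +
      a (j / M) * cellVar σ' (N * M) j - ∫ u in gridCell (N * M) j, b' u) ^ 2 /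
      (cellVar σ' (N * M) j) ≤ c ^ 2 * (1 / ((N * M : ℕ) : ℝ)) := by
    intro j
    have hk : (j : ℕ) / M < N := Nat.div_lt_of_lt_mul (j.2.trans_eq (mul_comm N M))
    have hsub : gridCell (N * M) j ⊆ gridCell N (j / M) := by
      rw [gridCell, gridCell, ← gridPt_mul_mul N _ hM, ← gridPt_mul_mul N (_ + 1) hM]
      refine Set.Ioc_subset_Ioc (monotone_gridPt _ (Nat.div_mul_le_self _ _))
        (monotone_gridPt _ ?_)
      rw [add_mul, one_mul]
      exact Nat.lt_div_mul_add hM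
    have e : (∫ u in gridCell (N * M) j, b₀' u) + a (j / M) * cellVar σ' (N * M) j -
        ∫ u in gridCell (N * M) j, b' u =
        ∫ u in gridCell (N * M) j, (a (j / M) * σ' u ^ 2 - (b' u - b₀' u)) := by
      have i1 : IntegrableOn (fun u => a (j / M) * σ' u ^ 2) (gridCell (N * M) j) :=
        integrableOn_of_continuous ((hσ'.pow 2).const_mul _) _
      have i2 : IntegrableOn (fun u => b' u - b₀' u) (gridCell (N * M) j) :=
        integrableOn_of_continuous (hb'.sub hb₀') _
      rw [coe_cellVar, integral_sub i1 i2, integral_const_mul,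
        integral_sub (integrableOn_of_continuous hb' _) (integrableOn_of_continuous hb₀' _)]
      ring
    rw [e, coe_cellVar]
    refine sq_setIntegral_div_le hσ' (by fun_prop) h0' j.2 fun t ht => ?_
    have h1 := hc _ hk t (hsub ht)
    have hs := h0' t
    have e2 : a (j / M) * σ' t ^ 2 - (b' t - b₀' t) =
        (a (j / M) * σ' t - (b' t - b₀' t) / σ' t) * σ' t := by
      field_simp
    rw [e2, abs_mul, abs_of_pos hs]
    exact mul_le_mul_of_nonneg_right h1 hs.le
  refine (Finset.sum_le_sum fun j _ => hcell j).trans (le_of_eq ?_)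
  rw [Finset.sum_const, Finset.card_univ, Fintype.card_fin, nsmul_eq_mul]
  field_simp

/-! ### A bound for the deficiency of two white noise experiments -/

/-- Write `u = d t / σ t`. On the cell `d` is close to `u σ`, so the transported signal is close to
`u κ`, with `κ = (∫ σ) σ' t / √(∫ σ² ∫ σ'²)`. Here `κ` lies within a factor `(1 + ρ)³` of `1`: one
power comes from `∫ σ` and one from each of the two variances under the root. -/
theorem abs_cellSlope_mul_sub_le {d σ σ' : unitInterval → ℝ} (hd : Continuous d)
    (hσ : Continuous σ) (hσ' : Continuous σ') (h0 : ∀ t, 0 < σ t) (h0' : ∀ t, 0 < σ' t) {N k : ℕ}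
    (hk : k < N) {ρ ω U : ℝ} (hρ : 0 ≤ ρ)
    (hσρ : ∀ x ∈ gridCell N k, ∀ y ∈ gridCell N k, σ x ≤ (1 + ρ) * σ y)
    (hσρ' : ∀ x ∈ gridCell N k, ∀ y ∈ gridCell N k, σ' x ≤ (1 + ρ) * σ' y)
    (hω : ∀ x ∈ gridCell N k, ∀ y ∈ gridCell N k, |d x / σ x - d y / σ y| ≤ ω)
    {t : unitInterval} (ht : t ∈ gridCell N k) (hU : |d t / σ t| ≤ U) :
    |cellSlope d σ σ' N k * σ' t - d t / σ t| ≤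
      ω * (1 + ρ) ^ 3 + U * ((1 + ρ) ^ 3 - 1) := by
  have hN : (0 : ℝ) < N := by exact_mod_cast (Nat.zero_le k).trans_lt hk
  set q := 1 + ρ with hq
  have hq1 : 1 ≤ q := by linarith
  have hq0 : 0 < q := by linarith
  set u := d t / σ t
  have hs := h0 t
  have hs' := h0' t
  have bd : ∀ {τ : unitInterval → ℝ}, Continuous τ → (∀ t, 0 < τ t) →
      (∀ x ∈ gridCell N k, ∀ y ∈ gridCell N k, τ x ≤ q * τ y) →
      (τ t / q) ^ 2 * (1 / N) ≤ ∫ x in gridCell N k, τ x ^ 2 ∧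
        ∫ x in gridCell N k, τ x ^ 2 ≤ (q * τ t) ^ 2 * (1 / N) := by
    intro τ hτ hτ0 hτq
    refine setIntegral_gridCell_bounds (hτ.pow 2) hk fun x hx => ⟨?_, ?_⟩
    · have := hτ0 t
      exact pow_le_pow_left₀ (by positivity) ((div_le_iff₀' hq0).2 (hτq t ht x hx)) 2
    · exact pow_le_pow_left₀ (hτ0 x).le (hτq x hx t ht) 2
  obtain ⟨hS1, hS2⟩ := setIntegral_gridCell_bounds hσ hk (lo := σ t / q) (hi := q * σ t)
    fun x hx => ⟨(div_le_iff₀' hq0).2 (hσρ t ht x hx), hσρ x hx t ht⟩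
  obtain ⟨hV1, hV2⟩ := bd hσ h0 hσρ
  obtain ⟨hV1', hV2'⟩ := bd hσ' h0' hσρ'
  have hdiff : |(∫ x in gridCell N k, d x) - u * ∫ x in gridCell N k, σ x| ≤
      ω * ∫ x in gridCell N k, σ x := by
    have i1 := integrableOn_of_continuous hd (gridCell N k)
    have i2 : IntegrableOn (fun x => u * σ x) (gridCell N k) :=
      integrableOn_of_continuous (hσ.const_mul u) (gridCell N k)
    rw [← integral_const_mul, ← integral_sub i1 i2, ← integral_const_mul]
    refine abs_integral_le_integral_abs.trans (setIntegral_mono_on (i1.sub i2).abs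
      (integrableOn_of_continuous (hσ.const_mul ω) _) (measurableSet_gridCell N k) fun x hx => ?_)
    have hx0 := h0 x
    have : d x - u * σ x = (d x / σ x - u) * σ x := by field_simp
    rw [this, abs_mul, abs_of_pos hx0]
    exact mul_le_mul_of_nonneg_right (hω x hx t ht) hx0.le
  unfold cellSlope
  set S := ∫ x in gridCell N k, σ x
  set V := ∫ x in gridCell N k, σ x ^ 2
  set V' := ∫ x in gridCell N k, σ' x ^ 2
  set D := ∫ x in gridCell N k, d x
  have hω0 : 0 ≤ ω := (abs_nonneg _).trans (hω t ht t ht)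
  have hV0 : 0 < V := lt_of_lt_of_le (by positivity) hV1
  have hV0' : 0 < V' := lt_of_lt_of_le (by positivity) hV1'
  set W := Real.sqrt (V * V') with hW
  have hW0 : 0 < W := Real.sqrt_pos.2 (by positivity)
  have hW1 : σ t * σ' t * (1 / N) ≤ q ^ 2 * W := by
    have : σ t * σ' t * (1 / N) / q ^ 2 ≤ W := by
      refine Real.le_sqrt_of_sq_le ?_
      calc (σ t * σ' t * (1 / N) / q ^ 2) ^ 2
          = (σ t / q) ^ 2 * (1 / N) * ((σ' t / q) ^ 2 * (1 / N)) := by field_simp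
        _ ≤ V * V' := by gcongr
    rwa [div_le_iff₀' (by positivity)] at this
  have hW2 : W ≤ q ^ 2 * (σ t * σ' t * (1 / N)) := by
    refine Real.sqrt_le_iff.2 ⟨by positivity, ?_⟩
    calc V * V' ≤ (q * σ t) ^ 2 * (1 / N) * ((q * σ' t) ^ 2 * (1 / N)) := by gcongr
      _ = _ := by ring
  set κ := S * σ' t / W with hκ
  have hκ1 : κ ≤ q ^ 3 := by
    rw [hκ, div_le_iff₀ hW0]
    calc S * σ' t ≤ q * σ t * (1 / N) * σ' t := by gcongr
      _ = q * (σ t * σ' t * (1 / N)) := by ring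
      _ ≤ q * (q ^ 2 * W) := by gcongr
      _ = q ^ 3 * W := by ring
  have hκ2 : 1 ≤ q ^ 3 * κ := by
    rw [hκ, mul_div_assoc', le_div_iff₀ hW0, one_mul]
    calc W ≤ q ^ 2 * (σ t * σ' t * (1 / N)) := hW2
      _ = q ^ 3 * (σ t / q * (1 / N) * σ' t) := by field_simp
      _ ≤ q ^ 3 * (S * σ' t) := by gcongr
  have hq3 : 1 ≤ q ^ 3 := one_le_pow₀ hq1
  have hκ0 : 0 ≤ κ := by nlinarith
  have hκ3 : |κ - 1| ≤ q ^ 3 - 1 := by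
    rw [abs_le]
    refine ⟨?_, by linarith⟩
    rcases le_total κ 1 with h | h <;> nlinarith
  have hU0 : 0 ≤ U := (abs_nonneg _).trans hU
  have e : D / W * σ' t - u = (D - u * S) * (σ' t / W) + u * (κ - 1) := by
    rw [hκ]
    field_simp
    ring
  rw [e]
  refine (abs_add_le _ _).trans (add_le_add ?_ ?_)
  · rw [abs_mul, abs_of_pos (show 0 < σ' t / W by positivity)]
    calc _ ≤ ω * S * (σ' t / W) := by gcongr
      _ = ω * κ := by rw [hκ]; ring
      _ ≤ ω * q ^ 3 := by gcongr
  · rw [abs_mul]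
    gcongr

theorem exists_ratio_le_of_continuous {σ : unitInterval → ℝ} (hσ : Continuous σ)
    (h0 : ∀ t, 0 < σ t) {ρ : ℝ} (hρ : 0 < ρ) :
    ∃ δ > 0, ∀ x y : unitInterval, |(x : ℝ) - y| < δ → σ x ≤ (1 + ρ) * σ y := by
  obtain ⟨z, -, hz⟩ := isCompact_univ.exists_isMinOn Set.univ_nonempty hσ.continuousOn
  have huc := CompactSpace.uniformContinuous_of_continuous hσ
  obtain ⟨δ, hδ, h⟩ := Metric.uniformContinuous_iff.1 huc (ρ * σ z) (mul_pos hρ (h0 z))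
  refine ⟨δ, hδ, fun x y hxy => ?_⟩
  have h1 : dist (σ x) (σ y) < ρ * σ z := h hxy
  have h2 : σ z ≤ σ y := hz (Set.mem_univ y)
  rw [Real.dist_eq] at h1
  have h3 := (abs_lt.1 h1).2
  nlinarith

/-- If the standardized signals of two white noise experiments, centred at a common parameter `t₀`,
are uniformly `η`-close, and those of the first experiment are uniformly bounded and
equicontinuous, then the deficiency of the first experiment with respect to the second is of the
order of `η`. -/
theorem deficiency_whiteNoise_le {T : Type*} (t₀ : T) {b b' : T → unitInterval → ℝ}
    {σ σ' : unitInterval → ℝ} (hb : ∀ f, Continuous (b f)) (hb' : ∀ f, Continuous (b' f))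
    (hσ : Continuous σ) (hσ' : Continuous σ') (h0 : ∀ t, 0 < σ t) (h0' : ∀ t, 0 < σ' t)
    {P Q : T → Measure C(unitInterval, ℝ)} (hP : ∀ f, IsWhiteNoiseLaw (b f) σ (P f))
    (hQ : ∀ f, IsWhiteNoiseLaw (b' f) σ' (Q f)) {η U : ℝ} (hη : 0 < η)
    (hclose : ∀ f t, |(b f t - b t₀ t) / σ t - (b' f t - b' t₀ t) / σ' t| ≤ η)
    (hU : ∀ f t, |(b f t - b t₀ t) / σ t| ≤ U)
    (hequi : ∀ ω > 0, ∃ δ > 0, ∀ f, ∀ x y : unitInterval, |(x : ℝ) - y| < δ →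
      |(b f x - b t₀ x) / σ x - (b f y - b t₀ y) / σ y| ≤ ω) :
    deficiency P Q ≤ ENNReal.ofReal (Real.sqrt (Real.exp ((2 * η) ^ 2) - 1)) := by
  have hU0 : 0 ≤ U := (abs_nonneg _).trans (hU t₀ 0)
  -- For `ρ ≤ 1` one has `(1 + ρ)³ ≤ 1 + 7ρ ≤ 8`, whence the `7` here and the `η / 16` below: each
  -- of the two error terms is at most `η / 2`.
  obtain ⟨ρ, hρ0, hρ1, hρ⟩ : ∃ ρ : ℝ, 0 < ρ ∧ ρ ≤ 1 ∧ 7 * U * ρ ≤ η / 2 := by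
    refine ⟨min 1 (η / (14 * (U + 1))), by positivity, min_le_left _ _, ?_⟩
    calc 7 * U * min 1 (η / (14 * (U + 1))) ≤ 7 * (U + 1) * (η / (14 * (U + 1))) := by
          gcongr
          · linarith
          · exact min_le_right _ _
      _ = η / 2 := by field_simp; ring
  obtain ⟨δ₁, hδ₁, h₁⟩ := exists_ratio_le_of_continuous hσ h0 hρ0
  obtain ⟨δ₂, hδ₂, h₂⟩ := exists_ratio_le_of_continuous hσ' h0' hρ0
  obtain ⟨δ₃, hδ₃, h₃⟩ := hequi (η / 16) (by positivity)
  obtain ⟨n, hn⟩ := exists_nat_one_div_lt (lt_min hδ₁ (lt_min hδ₂ hδ₃))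
  set N := n + 1 with hNdef
  have hn' : 1 / (N : ℝ) < min δ₁ (min δ₂ δ₃) := by rw [hNdef]; push_cast; exact hn
  have hR := (hQ t₀).isProbabilityMeasure
  -- The grid was chosen from moduli common to all parameters, so one kernel serves every `f`.
  refine iInf₂_le_of_le (transportKernel (b t₀) (b' t₀) σ σ' N (Q t₀)) inferInstance
    (iSup_le fun f => ?_)
  refine tvDist_bind_transportKernel_le (hb t₀) (hb f) (hb' t₀) (hb' f) hσ hσ' h0 h0' (hP f)
    (hQ t₀) (hQ f) (Nat.succ_pos n) fun k hk t ht => ?_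
  have hd : ∀ x ∈ gridCell N k, ∀ y ∈ gridCell N k, |(x : ℝ) - y| < min δ₁ (min δ₂ δ₃) :=
    fun x hx y hy => (dist_lt_of_mem_gridCell hk hx hy).trans hn'
  have hmain := abs_cellSlope_mul_sub_le (d := fun u => b f u - b t₀ u) ((hb f).sub (hb t₀))
    hσ hσ' h0 h0' hk hρ0.le
    (fun x hx y hy => h₁ x y ((hd x hx y hy).trans_le (min_le_left _ _)))
    (fun x hx y hy => h₂ x y
      ((hd x hx y hy).trans_le ((min_le_right _ _).trans (min_le_left _ _))))
    (fun x hx y hy => h₃ f x y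
      ((hd x hx y hy).trans_le ((min_le_right _ _).trans (min_le_right _ _)))) ht (hU f t)
  have hc := hclose f t
  have hρ3 : (1 + ρ) ^ 3 ≤ 1 + 7 * ρ := by nlinarith [mul_nonneg hρ0.le (sub_nonneg.2 hρ1)]
  have hb1 : η / 16 * (1 + ρ) ^ 3 ≤ η / 2 := by nlinarith
  have hb2 : U * ((1 + ρ) ^ 3 - 1) ≤ η / 2 := by nlinarith
  calc _ = |(cellSlope (fun u => b f u - b t₀ u) σ σ' N k * σ' t - (b f t - b t₀ t) / σ t) +
        ((b f t - b t₀ t) / σ t - (b' f t - b' t₀ t) / σ' t)| := by congr 1; ring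
    _ ≤ _ := abs_add_le _ _
    _ ≤ (η / 2 + η / 2) + η := add_le_add (hmain.trans (add_le_add hb1 hb2)) hc
    _ = 2 * η := by ring

/-! ### Equicontinuity of Hölder balls -/

theorem exists_iteratedDerivWithin_succ_eq_slope {g : ℝ → ℝ} {j m : ℕ}
    (hg : ContDiffOn ℝ m g (Set.Icc 0 1)) (hj : j < m) {x y : ℝ} (hx : 0 ≤ x) (hxy : x < y)
    (hy : y ≤ 1) :
    ∃ z ∈ Set.Ioo x y, iteratedDerivWithin j g (Set.Icc 0 1) y -
      iteratedDerivWithin j g (Set.Icc 0 1) x =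
        iteratedDerivWithin (j + 1) g (Set.Icc 0 1) z * (y - x) := by
  have hd : DifferentiableOn ℝ (iteratedDerivWithin j g (Set.Icc 0 1)) (Set.Icc 0 1) :=
    hg.differentiableOn_iteratedDerivWithin (by exact_mod_cast hj) (uniqueDiffOn_Icc zero_lt_one)
  have hsub : Set.Icc x y ⊆ Set.Icc 0 1 := Set.Icc_subset_Icc hx hy
  obtain ⟨z, hz, h⟩ := exists_hasDerivAt_eq_slope (iteratedDerivWithin j g (Set.Icc 0 1))
    (iteratedDerivWithin (j + 1) g (Set.Icc 0 1)) hxy (hd.continuousOn.mono hsub) fun z hz => by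
      rw [iteratedDerivWithin_succ]
      exact (hd z (hsub (Set.Ioo_subset_Icc_self hz))).hasDerivWithinAt.hasDerivAt
        (Icc_mem_nhds (hx.trans_lt hz.1) (hz.2.trans_le hy))
  refine ⟨z, hz, ?_⟩
  rw [h, div_mul_cancel₀ _ (sub_pos.2 hxy).ne']

/-- A function whose derivative of order `j` is bounded away from `0` on an interval takes a value
that is bounded away from `0` there. -/
theorem exists_abs_ge_of_iteratedDerivWithin_ge (j : ℕ) :
    ∃ κ > 0, ∀ (g : ℝ → ℝ) (m : ℕ), j ≤ m → ContDiffOn ℝ m g (Set.Icc 0 1) →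
      ∀ a b c : ℝ, 0 ≤ a → a < b → b ≤ 1 → 0 < c →
      (∀ x ∈ Set.Icc a b, c ≤ |iteratedDerivWithin j g (Set.Icc 0 1) x|) →
      ∃ x ∈ Set.Icc (0 : ℝ) 1, c * κ * (b - a) ^ j ≤ |g x| := by
  induction j with
  | zero =>
    refine ⟨1, one_pos, fun g m _ _ a b c ha hab hb hc h => ⟨a, ⟨ha, hab.le.trans hb⟩, ?_⟩⟩
    simpa using h a (Set.left_mem_Icc.2 hab.le)
  | succ j ih =>
    obtain ⟨κ, hκ, H⟩ := ih
    -- The induction hypothesis is applied with bound `c ℓ / 4` on an interval of length `ℓ / 4`,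
    -- which costs `(1/4)^(j+1)`.
    refine ⟨κ * (1 / 4) ^ (j + 1), by positivity, fun g m hj hg a b c ha hab hb hc h => ?_⟩
    set D := iteratedDerivWithin j g (Set.Icc 0 1)
    set ℓ := b - a with hℓ
    have hℓ0 : 0 < ℓ := sub_pos.2 hab
    have hsep : ∀ x ∈ Set.Icc a b, ∀ y ∈ Set.Icc a b, x < y → c * (y - x) ≤ |D y - D x| := by
      intro x hx y hy hxy
      obtain ⟨z, hz, he⟩ := exists_iteratedDerivWithin_succ_eq_slope hg
        (Nat.lt_of_succ_le hj) (ha.trans hx.1) hxy (hy.2.trans hb)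
      rw [he, abs_mul, abs_of_pos (sub_pos.2 hxy)]
      exact mul_le_mul_of_nonneg_right (h z ⟨hx.1.trans hz.1.le, hz.2.le.trans hy.2⟩)
        (sub_pos.2 hxy).le
    -- Points of the two outer quarters are at least `ℓ / 2` apart, so the values of `D` there
    -- differ by at least `c ℓ / 2`. Hence `|D|` cannot fall below `c ℓ / 4` in both quarters.
    obtain ⟨a', b', ha', hb', hlen, hD⟩ : ∃ a' b', 0 ≤ a' ∧ b' ≤ 1 ∧ b' - a' = ℓ / 4 ∧
        ∀ x ∈ Set.Icc a' b', c * ℓ / 4 ≤ |D x| := by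
      by_cases hcase : ∀ x ∈ Set.Icc a (a + ℓ / 4), c * ℓ / 4 ≤ |D x|
      · exact ⟨a, a + ℓ / 4, ha, by linarith, by ring, hcase⟩
      · push Not at hcase
        obtain ⟨x, hx, hxD⟩ := hcase
        refine ⟨b - ℓ / 4, b, by linarith, hb, by ring, fun y hy => ?_⟩
        by_contra! hyD
        have h1 := hsep x ⟨hx.1, by linarith [hx.2]⟩ y ⟨by linarith [hy.1], hy.2⟩
          (by linarith [hx.2, hy.1])
        have h2 := abs_sub (D y) (D x)
        have h3 : c * (ℓ / 2) ≤ c * (y - x) := by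
          gcongr
          linarith [hx.2, hy.1]
        linarith
    obtain ⟨x, hx, hgx⟩ := H g m ((Nat.le_succ j).trans hj) hg a' b' (c * ℓ / 4) ha'
      (by linarith) hb' (by positivity) hD
    refine ⟨x, hx, le_trans (le_of_eq ?_) hgx⟩
    rw [hlen]
    clear_value ℓ
    ring

/-- With oscillation at most `B`, a derivative that is very large at one point is large on all of
`[0,1]`, and this forces `|g|` beyond `A`. -/
theorem exists_bound_iteratedDerivWithin (j : ℕ) (A B : ℝ) :
    ∃ C : ℝ, ∀ (g : ℝ → ℝ) (m : ℕ), j ≤ m → ContDiffOn ℝ m g (Set.Icc 0 1) →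
      (∀ x ∈ Set.Icc (0 : ℝ) 1, |g x| ≤ A) →
      (∀ x ∈ Set.Icc (0 : ℝ) 1, ∀ y ∈ Set.Icc (0 : ℝ) 1,
        |iteratedDerivWithin j g (Set.Icc 0 1) x - iteratedDerivWithin j g (Set.Icc 0 1) y| ≤ B) →
      ∀ x ∈ Set.Icc (0 : ℝ) 1, |iteratedDerivWithin j g (Set.Icc 0 1) x| ≤ C := by
  obtain ⟨κ, hκ, H⟩ := exists_abs_ge_of_iteratedDerivWithin_ge j
  refine ⟨B + (|A| + 1) / κ, fun g m hj hg hA hB x hx => ?_⟩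
  by_contra! hlt
  obtain ⟨y, hy, hgy⟩ := H g m hj hg 0 1 ((|A| + 1) / κ) le_rfl one_pos le_rfl (by positivity)
    fun y hy => by
      have h1 := hB x hx y hy
      have h2 := abs_sub_abs_le_abs_sub (iteratedDerivWithin j g (Set.Icc 0 1) x)
        (iteratedDerivWithin j g (Set.Icc 0 1) y)
      linarith
  have h1 := hA y hy
  rw [div_mul_cancel₀ _ hκ.ne'] at hgy
  simp only [sub_zero, one_pow, mul_one] at hgy
  linarith [le_abs_self A]

/-- Descent in the order: a bound on one derivative bounds, by the mean value theorem on the unit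
interval, the oscillation of the derivative one order lower. -/
theorem exists_bound_iteratedDerivWithin_one (m : ℕ) (A B : ℝ) :
    ∃ C : ℝ, ∀ (g : ℝ → ℝ) (n : ℕ), m + 1 ≤ n → ContDiffOn ℝ n g (Set.Icc 0 1) →
      (∀ x ∈ Set.Icc (0 : ℝ) 1, |g x| ≤ A) →
      (∀ x ∈ Set.Icc (0 : ℝ) 1, ∀ y ∈ Set.Icc (0 : ℝ) 1,
        |iteratedDerivWithin (m + 1) g (Set.Icc 0 1) x -
          iteratedDerivWithin (m + 1) g (Set.Icc 0 1) y| ≤ B) →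
      ∀ x ∈ Set.Icc (0 : ℝ) 1, |iteratedDerivWithin 1 g (Set.Icc 0 1) x| ≤ C := by
  induction m generalizing B with
  | zero => exact exists_bound_iteratedDerivWithin 1 A B
  | succ m ih =>
    obtain ⟨C₁, h₁⟩ := exists_bound_iteratedDerivWithin (m + 1 + 1) A B
    obtain ⟨C₂, h₂⟩ := ih (max C₁ 0)
    refine ⟨C₂, fun g n hn hg hA hB => h₂ g n ((Nat.le_succ _).trans hn) hg hA ?_⟩
    have hb := h₁ g n hn hg hA hB
    have key : ∀ x ∈ Set.Icc (0 : ℝ) 1, ∀ y ∈ Set.Icc (0 : ℝ) 1, x < y →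
        |iteratedDerivWithin (m + 1) g (Set.Icc 0 1) y -
          iteratedDerivWithin (m + 1) g (Set.Icc 0 1) x| ≤ max C₁ 0 := by
      intro x hx y hy hxy
      obtain ⟨z, hz, he⟩ := exists_iteratedDerivWithin_succ_eq_slope hg
        (Nat.lt_of_succ_le hn) hx.1 hxy hy.2
      rw [he, abs_mul, abs_of_pos (sub_pos.2 hxy)]
      exact (mul_le_of_le_one_right (abs_nonneg _) (by linarith [hx.1, hy.2])).trans
        ((hb z ⟨hx.1.trans hz.1.le, hz.2.le.trans hy.2⟩).trans (le_max_left _ _))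
    intro x hx y hy
    rcases lt_trichotomy x y with h | h | h
    · rw [abs_sub_comm]
      exact key x hx y hy h
    · simp [h]
    · exact key y hy x hx h

theorem continuous_of_mem_holderBall {β L : ℝ} {f : unitInterval → ℝ} (hf : f ∈ holderBall β L) :
    Continuous f := by
  obtain ⟨-, m, α, -, -, -, hd, -⟩ := hf
  have h := continuousOn_iff_continuous_domRestrict.1 hd.continuousOn
  have h2 : Set.domRestrict (Set.Icc 0 1) (Set.IccExtend zero_le_one f) = f :=
    funext fun x => Set.IccExtend_val _ f x
  rwa [h2] at h

theorem equicontinuous_holder_order_zero (L α : ℝ) (hL : 0 ≤ L) (hα : 0 < α) {ε : ℝ} (hε : 0 < ε) :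
    ∃ δ > 0, ∀ r : ℝ, 0 ≤ r → r < δ → L * r ^ α ≤ ε := by
  refine ⟨(ε / (L + 1)) ^ α⁻¹, by positivity, fun r hr hlt => ?_⟩
  have h1 : r ^ α ≤ ε / (L + 1) := by
    have := Real.rpow_le_rpow hr hlt.le hα.le
    rwa [Real.rpow_inv_rpow (by positivity) hα.ne'] at this
  calc L * r ^ α ≤ (L + 1) * (ε / (L + 1)) := by
        gcongr
        linarith
    _ = ε := by field_simp

/-- Hölder balls are uniformly equicontinuous. -/
theorem equicontinuous_holderBall (β L : ℝ) {ε : ℝ} (hε : 0 < ε) :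
    ∃ δ > 0, ∀ f ∈ holderBall β L, ∀ x y : unitInterval, |(x : ℝ) - y| < δ → |f x - f y| ≤ ε := by
  by_cases hne : (holderBall β L).Nonempty
  swap
  · exact ⟨1, one_pos, fun f hf => (hne ⟨f, hf⟩).elim⟩
  obtain ⟨f₀, hf₀, m, α, hα0, hα1, hβ, -⟩ := hne
  have hL : 0 ≤ L := (abs_nonneg _).trans (hf₀ 0)
  -- As `0 < α ≤ 1`, the decomposition `β = m + α` is unique, so all functions of the ball share one
  -- order and one exponent.
  have huniq : ∀ (m' : ℕ) (α' : ℝ), 0 < α' → α' ≤ 1 → β = m' + α' → m' = m ∧ α' = α := by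
    intro m' α' h0 h1 h
    have h2 : (m' : ℝ) < m + 1 := by linarith
    have h3 : (m : ℝ) < m' + 1 := by linarith
    have h4 : m' < m + 1 := by exact_mod_cast h2
    have h5 : m < m' + 1 := by exact_mod_cast h3
    have h6 : m' = m := by omega
    subst h6
    exact ⟨rfl, by linarith⟩
  have hext : ∀ (f : unitInterval → ℝ) (x : unitInterval),
      Set.IccExtend zero_le_one f (x : ℝ) = f x := fun f x => Set.IccExtend_val _ f x
  -- For order zero the Hölder condition is itself the modulus. For positive order the first
  -- derivative is uniformly bounded, and the ball is uniformly Lipschitz.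
  cases m with
  | zero =>
    obtain ⟨δ, hδ, h⟩ := equicontinuous_holder_order_zero L α hL hα0 hε
    refine ⟨δ, hδ, fun f hf x y hxy => ?_⟩
    obtain ⟨-, m', α', h0, h1, h2, -, h3⟩ := hf
    obtain ⟨rfl, rfl⟩ := huniq m' α' h0 h1 h2
    have h4 := h3 x x.2 y y.2
    rw [iteratedDerivWithin_zero, hext, hext] at h4
    exact h4.trans (h _ (abs_nonneg _) hxy)
  | succ m =>
    obtain ⟨C, hC⟩ := exists_bound_iteratedDerivWithin_one m L L
    refine ⟨ε / (|C| + 1), by positivity, fun f hf x y hxy => ?_⟩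
    obtain ⟨hfL, m', α', h0, h1, h2, hd, h3⟩ := hf
    obtain ⟨rfl, rfl⟩ := huniq m' α' h0 h1 h2
    have hbd := hC _ (m + 1) le_rfl hd (fun z hz => by rw [hext f ⟨z, hz⟩]; exact hfL _)
      fun z hz w hw => (h3 z hz w hw).trans (by
        calc _ ≤ L * 1 := by
              gcongr
              refine Real.rpow_le_one (abs_nonneg _) ?_ h0.le
              rw [abs_le]
              constructor <;> linarith [hz.1, hz.2, hw.1, hw.2]
          _ = L := mul_one L)
    have key : ∀ x y : unitInterval, (x : ℝ) < y → |f y - f x| ≤ |C| * |(y : ℝ) - x| := by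
      intro x y hxy
      obtain ⟨z, hz, he⟩ := exists_iteratedDerivWithin_succ_eq_slope hd (Nat.succ_pos m)
        x.2.1 hxy y.2.2
      rw [iteratedDerivWithin_zero, hext, hext] at he
      rw [he, abs_mul]
      refine mul_le_mul_of_nonneg_right ?_ (abs_nonneg _)
      exact (hbd z ⟨x.2.1.trans hz.1.le, hz.2.le.trans y.2.2⟩).trans (le_abs_self C)
    have hlip : |f x - f y| ≤ |C| * |(x : ℝ) - y| := by
      rcases lt_trichotomy (x : ℝ) y with h | h | h
      · rw [abs_sub_comm, abs_sub_comm (x : ℝ)]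
        exact key x y h
      · rw [Subtype.ext h]
        simp
      · exact key y x h
    calc |f x - f y| ≤ |C| * |(x : ℝ) - y| := hlip
      _ ≤ (|C| + 1) * (ε / (|C| + 1)) := by
          gcongr
          linarith
      _ = ε := by field_simp

/-! ### The variance-stabilizing transform -/

theorem ExpFamily.analyticOnNhd_fisher (E : ExpFamily) : AnalyticOnNhd ℝ E.fisher E.Θ := by
  have hsub : E.Θ ⊆ interior (integrableExpSet E.U E.μ) :=
    interior_maximal (fun θ hθ => E.integrable_exp θ hθ) E.isOpen_Θ
  intro θ hθ
  have h : AnalyticAt ℝ (cgf E.U E.μ) θ := analyticAt_cgf (hsub hθ)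
  have h2 := h.iterated_deriv 2
  rw [← iteratedDeriv_eq_iterate] at h2
  exact h2

/-- The margin `ε₀` keeps `Θ₀` away from the boundary of `Θ`, so bounds on `Θ₀ ∩ [-L, L]` follow by
compactness of `closure Θ₀ ∩ [-L, L]`. -/
theorem ExpFamily.Regular.closure_subset {E : ExpFamily} {Θ₀ : Set ℝ} {Imin Imax ε₀ : ℝ}
    (hE : E.Regular Θ₀ Imin Imax ε₀) : closure Θ₀ ⊆ E.Θ := by
  intro x hx
  obtain ⟨y, hy, hd⟩ := Metric.mem_closure_iff.1 hx ε₀ hE.ε₀_pos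
  rw [Real.dist_eq] at hd
  exact (hE.le_Imax y hy x hd.le).1

theorem ExpFamily.Regular.fisher_le {E : ExpFamily} {Θ₀ : Set ℝ} {Imin Imax ε₀ : ℝ}
    (hE : E.Regular Θ₀ Imin Imax ε₀) {θ : ℝ} (hθ : θ ∈ Θ₀) : E.fisher θ ≤ Imax :=
  (hE.le_Imax θ hθ θ (by simpa using hE.ε₀_pos.le)).2

/-- The Fisher information is analytic and positive on `Θ`, so its root is `C¹` there, with
derivative bounded on the compact set `closure Θ₀ ∩ [-L, L]`. -/
theorem ExpFamily.Regular.exists_lipschitz_sqrt_fisher {E : ExpFamily} {Θ₀ : Set ℝ}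
    {Imin Imax ε₀ : ℝ} (hE : E.Regular Θ₀ Imin Imax ε₀) (L : ℝ) :
    ∃ C > 0, ∀ x ∈ Θ₀ ∩ Set.Icc (-L) L, ∀ y ∈ Θ₀ ∩ Set.Icc (-L) L,
      |Real.sqrt (E.fisher y) - Real.sqrt (E.fisher x)| ≤ C * |y - x| := by
  set g : ℝ → ℝ := fun θ => Real.sqrt (E.fisher θ)
  have hg : ContDiffOn ℝ 1 g E.Θ := fun θ hθ =>
    ((E.analyticOnNhd_fisher θ hθ).contDiffAt.sqrt (hE.fisher_pos θ hθ).ne').contDiffWithinAt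
  have hg' : ContinuousOn (deriv g) E.Θ := hg.continuousOn_deriv_of_isOpen E.isOpen_Θ le_rfl
  have hcomp : IsCompact (closure Θ₀ ∩ Set.Icc (-L) L) := isCompact_Icc.inter_left isClosed_closure
  obtain ⟨C, hC⟩ := hcomp.exists_bound_of_continuousOn
    (hg'.mono (Set.inter_subset_left.trans hE.closure_subset))
  have hconv : Convex ℝ (Θ₀ ∩ Set.Icc (-L) L) := hE.ordConnected.convex.inter (convex_Icc _ _)
  refine ⟨|C| + 1, by positivity, fun x hx y hy => ?_⟩
  refine hconv.norm_image_sub_le_of_norm_hasDerivWithin_le (f := g) (f' := deriv g)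
    (fun z hz => ?_) (fun z hz => ?_) hx hy
  · have hz' := hE.subset hz.1
    exact ((hg.differentiableOn one_ne_zero z hz').differentiableAt
      (E.isOpen_Θ.mem_nhds hz')).hasDerivAt.hasDerivWithinAt
  · exact (hC z ⟨subset_closure hz.1, hz.2⟩).trans ((le_abs_self C).trans (by linarith))

/-- The derivative of `Γ z - √I(x) z` is `√I(z) - √I(x)`, at most `C |y - x|` between `x` and `y`.
No second derivative of `Γ` is needed. -/
theorem ExpFamily.Regular.exists_taylor_bound {E : ExpFamily} {Θ₀ : Set ℝ} {Imin Imax ε₀ : ℝ}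
    (hE : E.Regular Θ₀ Imin Imax ε₀) {Γ : ℝ → ℝ}
    (hΓ : ∀ θ ∈ E.Θ, HasDerivAt Γ (Real.sqrt (E.fisher θ)) θ) (L : ℝ) :
    ∃ C > 0, ∀ x ∈ Θ₀ ∩ Set.Icc (-L) L, ∀ y ∈ Θ₀ ∩ Set.Icc (-L) L,
      |Γ y - Γ x - Real.sqrt (E.fisher x) * (y - x)| ≤ C * |y - x| ^ 2 := by
  obtain ⟨C, hC0, hC⟩ := hE.exists_lipschitz_sqrt_fisher L
  refine ⟨C, hC0, fun x hx y hy => ?_⟩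
  have hconv : Convex ℝ (Θ₀ ∩ Set.Icc (-L) L) := hE.ordConnected.convex.inter (convex_Icc _ _)
  have hseg : Set.uIcc x y ⊆ Θ₀ ∩ Set.Icc (-L) L := by
    rw [← segment_eq_uIcc]
    exact hconv.segment_subset hx hy
  have h := (convex_uIcc x y).norm_image_sub_le_of_norm_hasDerivWithin_le
    (f := fun z => Γ z - Real.sqrt (E.fisher x) * z)
    (f' := fun z => Real.sqrt (E.fisher z) - Real.sqrt (E.fisher x) * 1) (C := C * |y - x|)
    (fun z hz => ((hΓ z (hE.subset (hseg hz).1)).sub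
      ((hasDerivAt_id z).const_mul _)).hasDerivWithinAt)
    (fun z hz => ?_) Set.left_mem_uIcc Set.right_mem_uIcc
  · rw [Real.norm_eq_abs, Real.norm_eq_abs] at h
    calc _ = |Γ y - Real.sqrt (E.fisher x) * y - (Γ x - Real.sqrt (E.fisher x) * x)| := by
          congr 1
          ring
      _ ≤ C * |y - x| * |y - x| := h
      _ = _ := by ring
  · rw [mul_one, Real.norm_eq_abs]
    exact (hC x hx z (hseg hz)).trans
      (mul_le_mul_of_nonneg_left (Set.abs_sub_left_of_mem_uIcc hz) hC0.le)

theorem ExpFamily.Regular.lipschitz_stabilizer {E : ExpFamily} {Θ₀ : Set ℝ} {Imin Imax ε₀ : ℝ}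
    (hE : E.Regular Θ₀ Imin Imax ε₀) {Γ : ℝ → ℝ}
    (hΓ : ∀ θ ∈ E.Θ, HasDerivAt Γ (Real.sqrt (E.fisher θ)) θ) {x y : ℝ} (hx : x ∈ Θ₀)
    (hy : y ∈ Θ₀) : |Γ y - Γ x| ≤ Real.sqrt Imax * |y - x| := by
  refine hE.ordConnected.convex.norm_image_sub_le_of_norm_hasDerivWithin_le (f := Γ)
    (f' := fun z => Real.sqrt (E.fisher z))
    (fun z hz => (hΓ z (hE.subset hz)).hasDerivWithinAt) (fun z hz => ?_) hx hy
  rw [Real.norm_eq_abs, abs_of_nonneg (Real.sqrt_nonneg _)]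
  exact Real.sqrt_le_sqrt (hE.fisher_le hz)

/-! ### The local bound for Le Cam's distance -/

theorem rpow_neg_half {x : ℝ} (hx : 0 ≤ x) : x ^ (-(1 / 2) : ℝ) = (Real.sqrt x)⁻¹ := by
  rw [Real.rpow_neg hx, Real.sqrt_eq_rpow]

theorem equicontinuous_mul_sub {T : Type*} {s : unitInterval → ℝ} (hs : Continuous s)
    {d : T → unitInterval → ℝ} {D : ℝ} (hD : ∀ f t, |d f t| ≤ D)
    (hd : ∀ ω > 0, ∃ δ > 0, ∀ f, ∀ x y : unitInterval, |(x : ℝ) - y| < δ → |d f x - d f y| ≤ ω)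
    {ω : ℝ} (hω : 0 < ω) :
    ∃ δ > 0, ∀ f, ∀ x y : unitInterval, |(x : ℝ) - y| < δ →
      |s x * d f x - s y * d f y| ≤ ω := by
  obtain ⟨M, hM⟩ := isCompact_univ.exists_bound_of_continuousOn hs.continuousOn
  obtain ⟨δ₁, hδ₁, h₁⟩ := hd (ω / (2 * (|M| + 1))) (by positivity)
  obtain ⟨δ₂, hδ₂, h₂⟩ := Metric.uniformContinuous_iff.1
    (CompactSpace.uniformContinuous_of_continuous hs) (ω / (2 * (|D| + 1))) (by positivity)
  refine ⟨min δ₁ δ₂, lt_min hδ₁ hδ₂, fun f x y hxy => ?_⟩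
  have h3 := h₁ f x y (hxy.trans_le (min_le_left _ _))
  have h4 : dist (s x) (s y) < ω / (2 * (|D| + 1)) := h₂ (hxy.trans_le (min_le_right _ _))
  rw [Real.dist_eq] at h4
  have h5 : |s x| ≤ |M| + 1 := ((hM x trivial).trans (le_abs_self M)).trans (by linarith)
  have h6 : |d f y| ≤ |D| + 1 := ((hD f y).trans (le_abs_self D)).trans (by linarith)
  calc |s x * d f x - s y * d f y| = |s x * (d f x - d f y) + (s x - s y) * d f y| := by
        congr 1
        ring
    _ ≤ |s x * (d f x - d f y)| + |(s x - s y) * d f y| := abs_add_le _ _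
    _ = |s x| * |d f x - d f y| + |s x - s y| * |d f y| := by rw [abs_mul, abs_mul]
    _ ≤ (|M| + 1) * (ω / (2 * (|M| + 1))) + ω / (2 * (|D| + 1)) * (|D| + 1) := by gcongr
    _ = ω := by field_simp; ring

/-- Taylor's bound for the standardized signals is symmetric in the two experiments, so the
deficiency bound applies in both directions. `C` comes before `n`, `γ` and `f₀`, which gives
uniformity. -/
theorem exists_leCamDist_le {E : ExpFamily} {Θ₀ : Set ℝ} {Imin Imax ε₀ : ℝ}
    (hE : E.Regular Θ₀ Imin Imax ε₀) (β L : ℝ) {Γ : ℝ → ℝ}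
    (hΓ : ∀ θ ∈ E.Θ, HasDerivAt Γ (Real.sqrt (E.fisher θ)) θ) :
    ∃ C > 0, ∀ n : ℕ, 1 ≤ n → ∀ γ : ℝ, 0 < γ → ∀ f₀ ∈ paramSet Θ₀ β L,
      ∀ P Q : (unitInterval → ℝ) → Measure C(unitInterval, ℝ),
      (∀ f ∈ localSet Θ₀ β L f₀ γ, IsWhiteNoiseLaw f
        (fun t => (n : ℝ) ^ (-(1 / 2) : ℝ) * (E.fisher (f₀ t)) ^ (-(1 / 2) : ℝ)) (P f)) →
      (∀ f ∈ localSet Θ₀ β L f₀ γ, IsWhiteNoiseLaw (fun t => Γ (f t))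
        (fun _ => (n : ℝ) ^ (-(1 / 2) : ℝ)) (Q f)) →
      leCamDist (fun f : localSet Θ₀ β L f₀ γ => P f) (fun f : localSet Θ₀ β L f₀ γ => Q f) ≤
        ENNReal.ofReal (Real.sqrt (Real.exp ((2 * (C * Real.sqrt n * γ ^ 2)) ^ 2) - 1)) := by
  obtain ⟨C, hC0, hC⟩ := hE.exists_taylor_bound hΓ L
  refine ⟨C, hC0, fun n hn γ hγ f₀ hf₀ P Q hP hQ => ?_⟩
  have hn0 : (0 : ℝ) < n := by exact_mod_cast hn
  set r := Real.sqrt n with hr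
  have hr0 : 0 < r := Real.sqrt_pos.2 hn0
  have hmem : ∀ f ∈ paramSet Θ₀ β L, ∀ t, f t ∈ Θ₀ ∩ Set.Icc (-L) L := fun f hf t =>
    ⟨hf.1 t, abs_le.1 (hf.2.1 t)⟩
  have hpos : ∀ t, 0 < E.fisher (f₀ t) := fun t => hE.fisher_pos _ (hE.subset (hf₀.1 t))
  set s : unitInterval → ℝ := fun t => Real.sqrt (E.fisher (f₀ t)) with hs
  have hs0 : ∀ t, 0 < s t := fun t => Real.sqrt_pos.2 (hpos t)
  have hcf₀ := continuous_of_mem_holderBall hf₀.2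
  have hsc : Continuous s := Real.continuous_sqrt.comp
    (E.analyticOnNhd_fisher.continuousOn.comp_continuous hcf₀ fun t => hE.subset (hf₀.1 t))
  set T := localSet Θ₀ β L f₀ γ
  -- The neighbourhood contains its centre, at which both experiments are centred.
  let t₀ : T := ⟨f₀, hf₀, fun t => by simpa using hγ.le⟩
  have eσ : (fun t => (n : ℝ) ^ (-(1 / 2) : ℝ) * (E.fisher (f₀ t)) ^ (-(1 / 2) : ℝ)) =
      fun t => r⁻¹ * (s t)⁻¹ := by
    ext t
    rw [rpow_neg_half hn0.le, rpow_neg_half (hpos t).le]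
  rw [eσ] at hP
  rw [rpow_neg_half hn0.le] at hQ
  have hΓc : ContinuousOn Γ E.Θ := fun θ hθ => (hΓ θ hθ).continuousAt.continuousWithinAt
  have hbc : ∀ f : T, Continuous f.1 := fun f => continuous_of_mem_holderBall f.2.1.2
  have hbc' : ∀ f : T, Continuous fun t => Γ (f.1 t) := fun f =>
    hΓc.comp_continuous (hbc f) fun t => hE.subset (f.2.1.1 t)
  have hσc : Continuous fun t => r⁻¹ * (s t)⁻¹ :=
    (hsc.inv₀ fun t => (hs0 t).ne').const_mul _
  have hσ0 : ∀ t, 0 < r⁻¹ * (s t)⁻¹ := fun t => by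
    have := hs0 t
    positivity
  have hη : 0 < C * r * γ ^ 2 := by positivity
  have eu : ∀ (f : T) (t : unitInterval), (f.1 t - f₀ t) / (r⁻¹ * (s t)⁻¹) =
      r * s t * (f.1 t - f₀ t) := fun f t => by
    have := hs0 t
    field_simp
  have eu' : ∀ (f : T) (t : unitInterval), (Γ (f.1 t) - Γ (f₀ t)) / r⁻¹ =
      r * (Γ (f.1 t) - Γ (f₀ t)) := fun f t => by field_simp
  have hclose : ∀ (f : T) (t : unitInterval),
      |r * s t * (f.1 t - f₀ t) - r * (Γ (f.1 t) - Γ (f₀ t))| ≤ C * r * γ ^ 2 := by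
    intro f t
    have h1 := hC _ (hmem f₀ hf₀ t) _ (hmem f f.2.1 t)
    have h2 : |f.1 t - f₀ t| ≤ γ := f.2.2 t
    calc _ = |r * -(Γ (f.1 t) - Γ (f₀ t) - s t * (f.1 t - f₀ t))| := by congr 1; ring
      _ = r * |Γ (f.1 t) - Γ (f₀ t) - s t * (f.1 t - f₀ t)| := by
        rw [abs_mul, abs_neg, abs_of_pos hr0]
      _ ≤ r * (C * γ ^ 2) := by
        refine mul_le_mul_of_nonneg_left (h1.trans ?_) hr0.le
        gcongr
      _ = _ := by ring
  have hdiff : ∀ (f : T) t, |f.1 t - f₀ t| ≤ γ := fun f t => f.2.2 t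
  have hdiff' : ∀ (f : T) t, |Γ (f.1 t) - Γ (f₀ t)| ≤ Real.sqrt Imax * γ := fun f t =>
    (hE.lipschitz_stabilizer hΓ (hf₀.1 t) (f.2.1.1 t)).trans
      (mul_le_mul_of_nonneg_left (hdiff f t) (Real.sqrt_nonneg _))
  have hequi : ∀ ω > 0, ∃ δ > 0, ∀ f : T, ∀ x y : unitInterval, |(x : ℝ) - y| < δ →
      |(f.1 x - f₀ x) - (f.1 y - f₀ y)| ≤ ω := by
    intro ω hω
    obtain ⟨δ, hδ, h⟩ := equicontinuous_holderBall β L (half_pos hω)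
    refine ⟨δ, hδ, fun f x y hxy => ?_⟩
    calc _ = |(f.1 x - f.1 y) - (f₀ x - f₀ y)| := by congr 1; ring
      _ ≤ |f.1 x - f.1 y| + |f₀ x - f₀ y| := abs_sub _ _
      _ ≤ ω / 2 + ω / 2 := add_le_add (h f f.2.1.2 x y hxy) (h f₀ hf₀.2 x y hxy)
      _ = ω := by ring
  have hequi' : ∀ ω > 0, ∃ δ > 0, ∀ f : T, ∀ x y : unitInterval, |(x : ℝ) - y| < δ →
      |(Γ (f.1 x) - Γ (f₀ x)) - (Γ (f.1 y) - Γ (f₀ y))| ≤ ω := by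
    intro ω hω
    have hI := Real.sqrt_pos.2 hE.Imax_pos
    obtain ⟨δ, hδ, h⟩ := equicontinuous_holderBall β L
      (show 0 < ω / (2 * Real.sqrt Imax) by positivity)
    refine ⟨δ, hδ, fun f x y hxy => ?_⟩
    have hl : ∀ g ∈ paramSet Θ₀ β L, |Γ (g x) - Γ (g y)| ≤ ω / 2 := fun g hg => by
      refine (hE.lipschitz_stabilizer hΓ (hg.1 y) (hg.1 x)).trans ?_
      calc _ ≤ Real.sqrt Imax * (ω / (2 * Real.sqrt Imax)) :=
            mul_le_mul_of_nonneg_left (h g hg.2 x y hxy) hI.le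
        _ = ω / 2 := by field_simp
    calc _ = |(Γ (f.1 x) - Γ (f.1 y)) - (Γ (f₀ x) - Γ (f₀ y))| := by congr 1; ring
      _ ≤ |Γ (f.1 x) - Γ (f.1 y)| + |Γ (f₀ x) - Γ (f₀ y)| := abs_sub _ _
      _ ≤ ω / 2 + ω / 2 := add_le_add (hl f f.2.1) (hl f₀ hf₀)
      _ = ω := by ring
  obtain ⟨M, hM⟩ := isCompact_univ.exists_bound_of_continuousOn hsc.continuousOn
  refine max_le ?_ ?_
  · refine deficiency_whiteNoise_le (T := T) t₀ (b := fun f => f.1) (b' := fun f t => Γ (f.1 t))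
      (σ := fun t => r⁻¹ * (s t)⁻¹) (σ' := fun _ => r⁻¹) hbc hbc' hσc continuous_const hσ0
      (fun _ => by positivity) (fun f => hP f f.2) (fun f => hQ f f.2) hη (U := r * (|M| * γ))
      (fun f t => ?_) (fun f t => ?_) (fun ω hω => ?_)
    · change |(f.1 t - f₀ t) / (r⁻¹ * (s t)⁻¹) - (Γ (f.1 t) - Γ (f₀ t)) / r⁻¹| ≤ _
      rw [eu, eu']
      exact hclose f t
    · change |(f.1 t - f₀ t) / (r⁻¹ * (s t)⁻¹)| ≤ _
      rw [eu, mul_assoc, abs_mul, abs_mul, abs_of_pos hr0]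
      exact mul_le_mul_of_nonneg_left (mul_le_mul ((hM t trivial).trans (le_abs_self M))
        (hdiff f t) (abs_nonneg _) (abs_nonneg _)) hr0.le
    · obtain ⟨δ, hδ, h⟩ := equicontinuous_mul_sub (hsc.const_mul r) (T := T)
        (d := fun f t => f.1 t - f₀ t) hdiff hequi hω
      refine ⟨δ, hδ, fun f x y hxy => ?_⟩
      change |(f.1 x - f₀ x) / (r⁻¹ * (s x)⁻¹) - (f.1 y - f₀ y) / (r⁻¹ * (s y)⁻¹)| ≤ ω
      rw [eu, eu]
      exact h f x y hxy
  · refine deficiency_whiteNoise_le (T := T) t₀ (b' := fun f => f.1) (b := fun f t => Γ (f.1 t))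
      (σ' := fun t => r⁻¹ * (s t)⁻¹) (σ := fun _ => r⁻¹) hbc' hbc continuous_const hσc
      (fun _ => by positivity) hσ0 (fun f => hQ f f.2) (fun f => hP f f.2) hη
      (U := r * (Real.sqrt Imax * γ)) (fun f t => ?_) (fun f t => ?_) (fun ω hω => ?_)
    · change |(Γ (f.1 t) - Γ (f₀ t)) / r⁻¹ - (f.1 t - f₀ t) / (r⁻¹ * (s t)⁻¹)| ≤ _
      rw [eu, eu', abs_sub_comm]
      exact hclose f t
    · change |(Γ (f.1 t) - Γ (f₀ t)) / r⁻¹| ≤ _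
      rw [eu', abs_mul, abs_of_pos hr0]
      exact mul_le_mul_of_nonneg_left (hdiff' f t) hr0.le
    · obtain ⟨δ, hδ, h⟩ := equicontinuous_mul_sub (continuous_const (y := r)) (T := T)
        (d := fun f t => Γ (f.1 t) - Γ (f₀ t)) hdiff' hequi' hω
      refine ⟨δ, hδ, fun f x y hxy => ?_⟩
      change |(Γ (f.1 x) - Γ (f₀ x)) / r⁻¹ - (Γ (f.1 y) - Γ (f₀ y)) / r⁻¹| ≤ ω
      rw [eu', eu']
      exact h f x y hxy

/-! ### The rate -/

theorem gammaRate_pos {κ₀ : ℝ} (hκ₀ : 0 < κ₀) (β : ℝ) {n : ℕ} (hn : 2 ≤ n) :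
    0 < gammaRate κ₀ β n := by
  have h1 : (1 : ℝ) < n := by exact_mod_cast hn
  have h2 := Real.log_pos h1
  unfold gammaRate
  positivity

/-- The exponent of `n` is `1 - 4β/(2β+1) = -(2β-1)/(2β+1)`. -/
theorem natCast_mul_gammaRate_pow_four {β : ℝ} (hβ : 1 / 2 < β) (κ₀ : ℝ) {n : ℕ} (hn : 2 ≤ n) :
    (n : ℝ) * gammaRate κ₀ β n ^ 4 = κ₀ ^ 4 * ((n : ℝ) ^ (-((2 * β - 1) / (2 * β + 1))) *
      Real.log n ^ (4 * β / (2 * β + 1))) := by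
  have h1 : (1 : ℝ) < n := by exact_mod_cast hn
  have h0 : (0 : ℝ) < n := by linarith
  have h2 := Real.log_pos h1
  have hb : 2 * β + 1 ≠ 0 := by linarith
  have e1 : ((n : ℝ) / Real.log n) ^ (-(β / (2 * β + 1))) =
      (n : ℝ) ^ (-(β / (2 * β + 1))) * Real.log n ^ (β / (2 * β + 1)) := by
    rw [Real.div_rpow h0.le h2.le, Real.rpow_neg h2.le, div_inv_eq_mul]
  have e2 : (n : ℝ) ^ (-((2 * β - 1) / (2 * β + 1))) =
      n * ((n : ℝ) ^ (-(β / (2 * β + 1)))) ^ 4 := by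
    rw [← Real.rpow_mul_natCast h0.le]
    nth_rewrite 2 [← Real.rpow_one (n : ℝ)]
    rw [← Real.rpow_add h0]
    congr 1
    push_cast
    field_simp
    ring
  have e3 : Real.log n ^ (4 * β / (2 * β + 1)) = (Real.log n ^ (β / (2 * β + 1))) ^ 4 := by
    rw [← Real.rpow_mul_natCast h2.le]
    congr 1
    push_cast
    ring
  rw [gammaRate, e1, e2, e3]
  ring

theorem tendsto_rate {β : ℝ} (hβ : 1 / 2 < β) :
    Tendsto (fun n : ℕ => (n : ℝ) ^ (-((2 * β - 1) / (2 * β + 1))) *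
      Real.log n ^ (4 * β / (2 * β + 1))) atTop (𝓝 0) := by
  have hp : 0 < (2 * β - 1) / (2 * β + 1) := div_pos (by linarith) (by linarith)
  have h := ((isLittleO_log_rpow_rpow_atTop (4 * β / (2 * β + 1)) hp).tendsto_div_nhds_zero).comp
    (tendsto_natCast_atTop_atTop (R := ℝ))
  refine h.congr fun n => ?_
  simp only [Function.comp_apply]
  rw [Real.rpow_neg (Nat.cast_nonneg n), div_eq_inv_mul]

end VarStable

end

/-! ### Uniform asymptotic equivalence and its rate -/

open VarStable in
theorem theoremT
    (E : ExpFamily) (Θ₀ : Set ℝ) (Imin Imax ε₀ : ℝ) (hE : E.Regular Θ₀ Imin Imax ε₀)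
    (β L κ₀ : ℝ) (hβ : 1 / 2 < β) (hκ₀ : 0 < κ₀)
    (Γ : ℝ → ℝ) (hΓ : ∀ θ ∈ E.Θ, HasDerivAt Γ (Real.sqrt (E.fisher θ)) θ)
    -- `Q n f₀ f` is the law of `dY_t = f(t) dt + n^(-1/2) I(f₀(t))^(-1/2) dW_t`
    (Q : ℕ → (unitInterval → ℝ) → (unitInterval → ℝ) → Measure C(unitInterval, ℝ))
    (hQ : ∀ n : ℕ, 1 ≤ n → ∀ f₀ ∈ paramSet Θ₀ β L,
      ∀ f ∈ localSet Θ₀ β L f₀ (gammaRate κ₀ β n),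
        IsWhiteNoiseLaw f
          (fun t => (n : ℝ) ^ (-(1 / 2) : ℝ) * (E.fisher (f₀ t)) ^ (-(1 / 2) : ℝ)) (Q n f₀ f))
    -- `Qhat n f` is the law of `dY_t = Γ(f(t)) dt + n^(-1/2) dW_t`
    (Qhat : ℕ → (unitInterval → ℝ) → Measure C(unitInterval, ℝ))
    (hQhat : ∀ n : ℕ, 1 ≤ n → ∀ f ∈ paramSet Θ₀ β L,
        IsWhiteNoiseLaw (fun t => Γ (f t)) (fun _ => (n : ℝ) ^ (-(1 / 2) : ℝ)) (Qhat n f)) :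
    Tendsto
        (fun n : ℕ => ⨆ f₀ ∈ paramSet Θ₀ β L,
          leCamDist (fun f : localSet Θ₀ β L f₀ (gammaRate κ₀ β n) => Q n f₀ f)
            (fun f : localSet Θ₀ β L f₀ (gammaRate κ₀ β n) => Qhat n f))
        atTop (𝓝 0) ∧
      ∃ C : ℝ, ∀ᶠ n : ℕ in atTop,
        (⨆ f₀ ∈ paramSet Θ₀ β L,
          leCamDist (fun f : localSet Θ₀ β L f₀ (gammaRate κ₀ β n) => Q n f₀ f)
            (fun f : localSet Θ₀ β L f₀ (gammaRate κ₀ β n) => Qhat n f) ^ 2)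
        ≤ ENNReal.ofReal (C * ((n : ℝ) ^ (-((2 * β - 1) / (2 * β + 1)))
            * Real.log n ^ (4 * β / (2 * β + 1)))) := by
  obtain ⟨C, hC0, hC⟩ := exists_leCamDist_le hE β L hΓ
  set rate : ℕ → ℝ := fun n => (n : ℝ) ^ (-((2 * β - 1) / (2 * β + 1))) *
    Real.log n ^ (4 * β / (2 * β + 1)) with hrate
  -- The exponent `4 C² n γ_n⁴` equals `D * rate n / 2`, and `exp x - 1 ≤ 2 x` for `0 ≤ x ≤ 1`
  -- doubles it.
  set D : ℝ := 8 * C ^ 2 * κ₀ ^ 4 with hD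
  have htend : Tendsto (fun n => D * rate n) atTop (𝓝 0) := by
    simpa using (tendsto_rate hβ).const_mul D
  have hbound : ∀ᶠ n : ℕ in atTop, 0 ≤ D * rate n ∧ ∀ f₀ ∈ paramSet Θ₀ β L,
      leCamDist (fun f : localSet Θ₀ β L f₀ (gammaRate κ₀ β n) => Q n f₀ f)
        (fun f : localSet Θ₀ β L f₀ (gammaRate κ₀ β n) => Qhat n f) ≤
      ENNReal.ofReal (Real.sqrt (D * rate n)) := by
    -- From `n = 2` on, `log n` is positive; `D * rate n ≤ 1` brings the exponent into the range of
    -- the bound for `exp x - 1`.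
    filter_upwards [eventually_ge_atTop 2, htend.eventually (ge_mem_nhds one_pos)] with n hn h1
    have hn1 : 1 ≤ n := one_le_two.trans hn
    have hsq : (2 * (C * Real.sqrt n * gammaRate κ₀ β n ^ 2)) ^ 2 = D * rate n / 2 := by
      have h2 := natCast_mul_gammaRate_pow_four hβ κ₀ hn
      have h3 := Real.sq_sqrt (Nat.cast_nonneg (α := ℝ) n)
      calc _ = 4 * C ^ 2 * (Real.sqrt n ^ 2 * gammaRate κ₀ β n ^ 4) := by ring
        _ = D * rate n / 2 := by
          rw [h3, h2, hD]
          ring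
    have h0 : 0 ≤ D * rate n := by
      have := sq_nonneg (2 * (C * Real.sqrt n * gammaRate κ₀ β n ^ 2))
      linarith
    refine ⟨h0, fun f₀ hf₀ => ?_⟩
    refine (hC n hn1 _ (gammaRate_pos hκ₀ β hn) f₀ hf₀ (Q n f₀) (Qhat n) (hQ n hn1 f₀ hf₀)
      fun f hf => hQhat n hn1 f hf.1).trans ?_
    refine ENNReal.ofReal_le_ofReal (Real.sqrt_le_sqrt ?_)
    rw [hsq]
    have h4 := Real.abs_exp_sub_one_le (x := D * rate n / 2) (by
      rw [abs_of_nonneg (by linarith)]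
      linarith)
    rw [abs_of_nonneg (show 0 ≤ D * rate n / 2 by linarith)] at h4
    linarith [le_abs_self (Real.exp (D * rate n / 2) - 1)]
  refine ⟨?_, D, ?_⟩
  · have hlim : Tendsto (fun n => ENNReal.ofReal (Real.sqrt (D * rate n))) atTop (𝓝 0) := by
      have h := (Real.continuous_sqrt.tendsto 0).comp htend
      rw [Real.sqrt_zero] at h
      simpa using ENNReal.tendsto_ofReal h
    refine tendsto_of_tendsto_of_tendsto_of_le_of_le' tendsto_const_nhds hlim
      (Eventually.of_forall fun _ => zero_le) ?_
    filter_upwards [hbound] with n hn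
    exact iSup₂_le hn.2
  · filter_upwards [hbound] with n hn
    refine iSup₂_le fun f₀ hf₀ => (pow_le_pow_left₀ zero_le (hn.2 f₀ hf₀) 2).trans ?_
    rw [← ENNReal.ofReal_pow (Real.sqrt_nonneg _), Real.sq_sqrt hn.1]
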